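/- Let $M\ge 1$, let $F$ be a complex Hilbert space with an orthonormal basis $(|n\rangle)_{n\in\mathbb N_0}$ (for instance $F=L^2(\mathbb R)$ with the Hermite functions), and let $a|n\rangle=\sqrt n\,|n-1\rangle$, $a^*|n\rangle=\sqrt{n+1}\,|n+1\rangle$, $N=a^*a$. For each of $M$ two-level atoms let $|1\rangle$ be the excited and $|0\rangle$ the ground state, $\sigma_3|1\rangle=|1\rangle$, $\sigma_3|0\rangle=-|0\rangle$, $\sigma_\pm=\sigma_1\pm i\sigma_2$ (so $\sigma_+|0\rangle=2|1\rangle$), and $S_\alpha=\sum_{j=1}^M\sigma_{\alpha,j}$ on $(\mathbb C^2)^{\otimes M}$, where $\sigma_{\alpha,j}$ is $\sigma_\alpha$ acting on atom $j$. Let $\mathcal H_{\mathrm{sym}}=(\mathbb C^2)^{\otimes M}_{\mathrm{sym}}\otimes F$ be the permutation-symmetric (Bose) subspace of $(\mathbb C^2)^{\otimes M}\otimes F$, let $D_{\mathrm{sym}}$ be the space of the permutation-symmetric finite linear combinations of the vectors $|b_1\rangle\otimes\dots\otimes|b_M\rangle\otimes|n\rangle$, and consider on $D_{\mathrm{sym}}$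 the operators $$H_1=S_3\otimes 1,\qquad H_2=S_+\otimes a+S_-\otimes a^*,\qquad H_3=1\otimes N,\qquad X_M=\tfrac12(S_3+M1)\otimes 1+1\otimes N .$$ The eigenvalues of $X_M$ are the $\mu\in\mathbb N_0$; let $\mathcal H^{(\mu)}_{\mathrm{sym}}$ be its eigenspaces. Let $\mathcal U(X_M)$ be the group of the unitaries on $\mathcal H_{\mathrm{sym}}$ that commute with $e^{i\alpha X_M}$ for all $\alpha\in\mathbb R$, and let the dynamical group $\mathcal G$ be the smallest subgroup of the unitary group of $\mathcal H_{\mathrm{sym}}$ that is closed in the strong operator topology (relative to the unitary group) and contains $e^{itH_k}$ for all $t\in\mathbb R$ and $k=1,2,3$. Here $e^{itA}$ is the strongly continuous one-parameter unitary group generated by the closure of $A$. Then: 1. The one-parameter groups $e^{itH_k}$ ($k=1,2,3$) and $e^{i\alpha X_M}$ exist, and $\mathcal G$ is a strongly closed subgroup of $\mathcal U(X_M)$. 2. For each $V\in\mathcal U(X_M)$ and each $\mu\in\mathbb N_0$ there is $U\in\mathcal G$ with $U\psi=V\psi$ for all $\psi\in\mathcal H^{(\mu)}_{\mathrm{sym}}$.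 3. For each $\mu\in\mathbb N_0$, the real Lie algebra of operators on $D_{\mathrm{sym}}$ generated by $iH_1,iH_2,iH_3$ leaves $\mathcal H^{(\mu)}_{\mathrm{sym}}$ invariant, and its restriction to $\mathcal H^{(\mu)}_{\mathrm{sym}}$ is the Lie algebra $\mathfrak u(\mathcal H^{(\mu)}_{\mathrm{sym}})$ of all skew-adjoint operators on $\mathcal H^{(\mu)}_{\mathrm{sym}}$. -/

import Mathlib

open scoped Topology

noncomputable section

namespace TavisCummings

/-! ### Unbounded operators, one-parameter unitary groups, dynamical groups -/

section General

variable {E : Type*} [NormedAddCommGroup E] [InnerProductSpace ℂ E]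

/-- An operator with invariant domain `D`, as an unbounded operator on `E`. -/
def toPMap {D : Submodule ℂ E} (A : Module.End ℂ D) : E →ₗ.[ℂ] E :=
  ⟨D, D.subtype ∘ₗ A⟩

/-- `W t = exp (i t A)`: `W` is a strongly continuous one-parameter group of unitaries whose
infinitesimal generator is `i` times the closure of `A` (whose graph is the closure of the
graph of `A`). By Stone's theorem such a `W` exists exactly if the closure of `A` is
selfadjoint (for densely defined `A` on a Hilbert space), and it is unique. -/
structure IsExp (A : E →ₗ.[ℂ] E) (W : ℝ → (E ≃ₗᵢ[ℂ] E)) : Prop where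
  add : ∀ s t, W (s + t) = W s * W t
  cont : ∀ ψ, Continuous fun t => W t ψ
  gen : ∀ ψ φ : E, HasDerivAt (fun t => W t ψ) (Complex.I • φ) 0 ↔
    (ψ, φ) ∈ A.graph.topologicalClosure

/-- The strong operator topology (pointwise convergence) on the unitary group of `E`. -/
abbrev strongTopology (E : Type*) [NormedAddCommGroup E] [InnerProductSpace ℂ E] :
    TopologicalSpace (E ≃ₗᵢ[ℂ] E) :=
  TopologicalSpace.induced (fun U : E ≃ₗᵢ[ℂ] E => (U : E → E)) inferInstance

/-- The dynamical group of the control Hamiltonians `H k`: the smallest strongly closed subgroup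
of the unitary group that contains all `exp (i t H k)`. -/
def dynamicalGroup {κ : Type*} (H : κ → (E →ₗ.[ℂ] E)) : Subgroup (E ≃ₗᵢ[ℂ] E) :=
  sInf {S | IsClosed[strongTopology E] (S : Set (E ≃ₗᵢ[ℂ] E)) ∧
    ∀ k W, IsExp (H k) W → ∀ t, W t ∈ S}

/-- The group `𝒰(X)` of the unitaries that commute with the representation
`exp (i α) ↦ exp (i α X)` of `U(1)`. -/
def chargeGroup (X : E →ₗ.[ℂ] E) : Subgroup (E ≃ₗᵢ[ℂ] E) :=
  Subgroup.centralizer {P | ∃ W, IsExp X W ∧ ∃ α, P = W α}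

/-- Membership in the real Lie algebra, with the commutator as bracket, that is generated by a
family of operators on a complex vector space. -/
inductive InLie {D κ : Type*} [AddCommGroup D] [Module ℂ D] (Q : κ → Module.End ℂ D) :
    Module.End ℂ D → Prop
  | zero : InLie Q 0
  | gen (k : κ) : InLie Q (Q k)
  | add {A B : Module.End ℂ D} : InLie Q A → InLie Q B → InLie Q (A + B)
  | smul (r : ℝ) {A : Module.End ℂ D} : InLie Q A → InLie Q ((r : ℂ) • A)
  | bracket {A B : Module.End ℂ D} : InLie Q A → InLie Q B → InLie Q (A * B - B * A)

end General

/-! ### The cavity mode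

The mode lives on a Hilbert space `F` with number basis `e n = |n⟩`; for `F = L²(ℝ)` this is the
basis of Hermite functions. -/

section Mode

variable {F : Type*} [NormedAddCommGroup F] [InnerProductSpace ℂ F] (e : HilbertBasis ℕ ℂ F)

/-- The finite linear combinations of the number states. -/
def modeDomain : Submodule ℂ F := Submodule.span ℂ (Set.range e)

/-- The number states, as an algebraic basis of their span. -/
def modeBasis : Module.Basis ℕ ℂ (modeDomain e) :=
  Module.Basis.span e.orthonormal.linearIndependent

/-- The annihilation operator: `a |n⟩ = √n |n - 1⟩`, and `a |0⟩ = 0`. -/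
def annihilation : Module.End ℂ (modeDomain e) :=
  (modeBasis e).constr ℂ fun n => ((Real.sqrt n : ℝ) : ℂ) • modeBasis e (n - 1)

/-- The creation operator: `a* |n⟩ = √(n + 1) |n + 1⟩`. -/
def creation : Module.End ℂ (modeDomain e) :=
  (modeBasis e).constr ℂ fun n => ((Real.sqrt (n + 1) : ℝ) : ℂ) • modeBasis e (n + 1)

/-- The number operator `N = a* a`. -/
def number : Module.End ℂ (modeDomain e) := creation e * annihilation e

end Mode

/-! ### The atoms

`|1⟩` is the excited state of an atom, so that the Pauli matrices, which have their usual form in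
the ordered basis `|1⟩, |0⟩`, are written below in the ordered basis `|0⟩, |1⟩`. -/

/-- `σ₁`. -/
def pauli1 : Matrix (Fin 2) (Fin 2) ℂ := !![0, 1; 1, 0]

/-- `σ₂`. -/
def pauli2 : Matrix (Fin 2) (Fin 2) ℂ := !![0, Complex.I; -Complex.I, 0]

/-- `σ₃`. -/
def pauli3 : Matrix (Fin 2) (Fin 2) ℂ := !![-1, 0; 0, 1]

/-- `σ₊ = σ₁ + i σ₂`. -/
def pauliPlus : Matrix (Fin 2) (Fin 2) ℂ := pauli1 + Complex.I • pauli2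

/-- `σ₋ = σ₁ - i σ₂`. -/
def pauliMinus : Matrix (Fin 2) (Fin 2) ℂ := pauli1 - Complex.I • pauli2

/-- The labels `b` of the canonical basis `|b⟩ = |b₁⟩ ⊗ … ⊗ |b_M⟩` of `(ℂ²)^{⊗ M}`. -/
abbrev Config (M : ℕ) := Fin M → Fin 2

/-- The one-atom operator `A` acting on atom `j`: the matrix of `1 ⊗ … ⊗ A ⊗ … ⊗ 1`. -/
def atomOp {M : ℕ} (A : Matrix (Fin 2) (Fin 2) ℂ) (j : Fin M) :
    Matrix (Config M) (Config M) ℂ :=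
  Matrix.of fun b c => if ∀ i, i ≠ j → b i = c i then A (b j) (c j) else 0

/-- The collective operator `∑ j, A_j`. -/
def collective (M : ℕ) (A : Matrix (Fin 2) (Fin 2) ℂ) : Matrix (Config M) (Config M) ℂ :=
  ∑ j, atomOp A j

/-- A matrix on `(ℂ²)^{⊗ M}` that commutes with the permutations of the atoms. -/
def PermInvariant {M : ℕ} (B : Matrix (Config M) (Config M) ℂ) : Prop :=
  ∀ (σ : Equiv.Perm (Fin M)) (b c : Config M), B (b ∘ σ) (c ∘ σ) = B b c

lemma permInvariant_collective (M : ℕ) (A : Matrix (Fin 2) (Fin 2) ℂ) :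
    PermInvariant (collective M A) := by
  intro σ b c
  simp only [collective, Matrix.sum_apply]
  refine Fintype.sum_equiv σ _ _ fun j => ?_
  have h : (∀ i, i ≠ j → b (σ i) = c (σ i)) ↔ ∀ i, i ≠ σ j → b i = c i := by
    constructor
    · intro h i hi
      have := h (σ.symm i) (fun h' => hi (by simp [← h']))
      simpa using this
    · intro h i hi
      exact h _ (fun h' => hi (σ.injective h'))
  simp [atomOp, h]

lemma permInvariant_one (M : ℕ) : PermInvariant (1 : Matrix (Config M) (Config M) ℂ) := by
  intro σ b c
  have h : b ∘ σ = c ∘ σ ↔ b = c := σ.surjective.injective_comp_right.eq_iff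
  simp only [Matrix.one_apply, h]

lemma PermInvariant.add {M : ℕ} {B C : Matrix (Config M) (Config M) ℂ} (hB : PermInvariant B)
    (hC : PermInvariant C) : PermInvariant (B + C) := by
  intro σ b c
  simp [hB σ b c, hC σ b c]

lemma PermInvariant.smul {M : ℕ} {B : Matrix (Config M) (Config M) ℂ} (z : ℂ)
    (hB : PermInvariant B) : PermInvariant (z • B) := by
  intro σ b c
  simp [hB σ b c]

/-! ### Atoms and mode together -/

section Coupled

/-- `(ℂ²)^{⊗ M} ⊗ F`; a vector `∑ b, |b⟩ ⊗ ψ b` is given by its components `ψ b ∈ F`. -/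
abbrev FullSpace (M : ℕ) (F : Type*) := PiLp 2 (fun _ : Config M => F)

variable {F : Type*} [NormedAddCommGroup F] [InnerProductSpace ℂ F]

/-- The symmetric subspace `(ℂ²)^{⊗ M}_sym ⊗ F`: the vectors invariant under all permutations of
the atoms. -/
def bose (M : ℕ) (F : Type*) [NormedAddCommGroup F] [InnerProductSpace ℂ F] :
    Submodule ℂ (FullSpace M F) where
  carrier := {ψ | ∀ (σ : Equiv.Perm (Fin M)) (b : Config M), ψ (b ∘ σ) = ψ b}
  add_mem' := by
    intro ψ φ hψ hφ σ b
    simp [hψ σ b, hφ σ b]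
  zero_mem' := by
    intro σ b
    simp
  smul_mem' := by
    intro z ψ hψ σ b
    simp [hψ σ b]

variable (e : HilbertBasis ℕ ℂ F) (M : ℕ)

/-- The span of the vectors `|b⟩ ⊗ |n⟩`. -/
def fullDomain : Submodule ℂ (FullSpace M F) where
  carrier := {ψ | ∀ b, ψ b ∈ modeDomain e}
  add_mem' := fun hψ hφ b => (modeDomain e).add_mem (hψ b) (hφ b)
  zero_mem' := fun _ => (modeDomain e).zero_mem
  smul_mem' := fun z _ hψ b => (modeDomain e).smul_mem z (hψ b)

/-- The span of the vectors `|ν⟩ ⊗ |n⟩`, i.e. the symmetric vectors in the span of the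
`|b⟩ ⊗ |n⟩`. -/
def symDomain : Submodule ℂ (bose M F) := (fullDomain e M).comap (bose M F).subtype

variable {M}

/-- `B ⊗ T`, on the span of the vectors `|b⟩ ⊗ |n⟩`. -/
def tensorOp (B : Matrix (Config M) (Config M) ℂ) (T : Module.End ℂ (modeDomain e)) :
    Module.End ℂ (fullDomain e M) where
  toFun ψ := ⟨WithLp.toLp 2 fun b => ∑ c, B b c • (T ⟨ψ.1 c, ψ.2 c⟩ : F), fun b =>
    (modeDomain e).sum_mem fun c _ => (modeDomain e).smul_mem _ (T ⟨ψ.1 c, ψ.2 c⟩).2⟩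
  map_add' ψ φ := by
    ext b
    have h : ∀ c, T ⟨(ψ + φ).1 c, (ψ + φ).2 c⟩ = T ⟨ψ.1 c, ψ.2 c⟩ + T ⟨φ.1 c, φ.2 c⟩ :=
      fun c => by rw [← map_add]; rfl
    change ∑ c, B b c • (T ⟨(ψ + φ).1 c, (ψ + φ).2 c⟩ : F) =
      ∑ c, B b c • (T ⟨ψ.1 c, ψ.2 c⟩ : F) + ∑ c, B b c • (T ⟨φ.1 c, φ.2 c⟩ : F)
    simp_rw [h]
    simp only [Submodule.coe_add, smul_add, Finset.sum_add_distrib]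
  map_smul' z ψ := by
    ext b
    have h : ∀ c, T ⟨(z • ψ).1 c, (z • ψ).2 c⟩ = z • T ⟨ψ.1 c, ψ.2 c⟩ :=
      fun c => by rw [← map_smul]; rfl
    change ∑ c, B b c • (T ⟨(z • ψ).1 c, (z • ψ).2 c⟩ : F) =
      z • ∑ c, B b c • (T ⟨ψ.1 c, ψ.2 c⟩ : F)
    simp_rw [h]
    simp only [Submodule.coe_smul, Finset.smul_sum, smul_comm z]

/-- The operator leaves the symmetric subspace invariant. -/
def LeavesBoseInvariant (A : Module.End ℂ (fullDomain e M)) : Prop :=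
  ∀ ψ : fullDomain e M, ψ.1 ∈ bose M F → (A ψ).1 ∈ bose M F

variable {e}

lemma tensorOp_invariant {B : Matrix (Config M) (Config M) ℂ} (hB : PermInvariant B)
    (T : Module.End ℂ (modeDomain e)) : LeavesBoseInvariant e (tensorOp e B T) := by
  intro ψ hψ σ b
  change ∑ c, B (b ∘ σ) c • (T ⟨ψ.1 c, ψ.2 c⟩ : F) = ∑ c, B b c • (T ⟨ψ.1 c, ψ.2 c⟩ : F)
  symm
  refine Fintype.sum_equiv (σ.arrowCongr (Equiv.refl _)).symm _ _ fun c => ?_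
  have hc : (σ.arrowCongr (Equiv.refl (Fin 2))).symm c = c ∘ σ := by
    ext i; simp [Equiv.arrowCongr]
  rw [hc, hB σ b c]
  congr 3
  exact Subtype.ext (hψ σ c).symm

lemma LeavesBoseInvariant.add {A B : Module.End ℂ (fullDomain e M)}
    (hA : LeavesBoseInvariant e A) (hB : LeavesBoseInvariant e B) :
    LeavesBoseInvariant e (A + B) :=
  fun ψ hψ => (bose M F).add_mem (hA ψ hψ) (hB ψ hψ)

/-- The restriction of an operator to the symmetric subspace. -/
def restrictBose (A : Module.End ℂ (fullDomain e M)) (hA : LeavesBoseInvariant e A) :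
    Module.End ℂ (symDomain e M) where
  toFun ψ := ⟨⟨(A ⟨ψ.1.1, ψ.2⟩).1, hA _ ψ.1.2⟩, (A ⟨ψ.1.1, ψ.2⟩).2⟩
  map_add' ψ φ := by
    apply Subtype.ext; apply Subtype.ext
    change (A (⟨ψ.1.1, ψ.2⟩ + ⟨φ.1.1, φ.2⟩)).1 = _
    rw [map_add]; rfl
  map_smul' z ψ := by
    apply Subtype.ext; apply Subtype.ext
    change (A (z • ⟨ψ.1.1, ψ.2⟩)).1 = _
    rw [map_smul]; rfl

variable (e M)

/-- `S₃ ⊗ 1` on the symmetric subspace. -/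
def tc1 : Module.End ℂ (symDomain e M) :=
  restrictBose (tensorOp e (collective M pauli3) 1)
    (tensorOp_invariant (permInvariant_collective M _) _)

/-- `S₊ ⊗ a + S₋ ⊗ a*` on the symmetric subspace. -/
def tc2 : Module.End ℂ (symDomain e M) :=
  restrictBose
    (tensorOp e (collective M pauliPlus) (annihilation e) +
      tensorOp e (collective M pauliMinus) (creation e))
    ((tensorOp_invariant (permInvariant_collective M _) _).add
      (tensorOp_invariant (permInvariant_collective M _) _))

/-- `1 ⊗ N` on the symmetric subspace. -/
def tc3 : Module.End ℂ (symDomain e M) :=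
  restrictBose (tensorOp e 1 (number e)) (tensorOp_invariant (permInvariant_one M) _)

/-- The three control Hamiltonians. -/
def tcHam : Fin 3 → Module.End ℂ (symDomain e M) := ![tc1 e M, tc2 e M, tc3 e M]

/-- The charge operator `X_M = ½ (S₃ + M 1) ⊗ 1 + 1 ⊗ N` on the symmetric subspace: its value on
`|ν⟩ ⊗ |n⟩` is the total number `ν + n` of excitations. -/
def charge : Module.End ℂ (symDomain e M) :=
  restrictBose
    (tensorOp e ((1 / 2 : ℂ) • (collective M pauli3 + (M : ℂ) • 1)) 1 + tensorOp e 1 (number e))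
    ((tensorOp_invariant
        (((permInvariant_collective M _).add ((permInvariant_one M).smul _)).smul _) _).add
      (tensorOp_invariant (permInvariant_one M) _))

/-- The dynamical group of the three control Hamiltonians. -/
def tcGroup : Subgroup (bose M F ≃ₗᵢ[ℂ] bose M F) :=
  dynamicalGroup fun k => toPMap (tcHam e M k)

/-- Membership in the real Lie algebra generated by `i H₁, i H₂, i H₃`, as operators on the joint
invariant domain. -/
def InTcLie : Module.End ℂ (symDomain e M) → Prop :=
  InLie fun k => Complex.I • tcHam e M k

/-- The eigenspace of the charge operator with eigenvalue `μ`. -/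
def chargeSpace (μ : ℕ) : Submodule ℂ (symDomain e M) :=
  Module.End.eigenspace (charge e M) (μ : ℂ)

/-- The inclusion of the charge space into the symmetric subspace. -/
def chargeIncl (μ : ℕ) : chargeSpace e M μ →ₗ[ℂ] bose M F :=
  (symDomain e M).subtype ∘ₗ (chargeSpace e M μ).subtype

end Coupled

end TavisCummings

end

noncomputable section

set_option linter.unusedSectionVars false

namespace TavisCummings

/-! ### Block diagonal unitaries on a Hilbert sum -/

section Block

open Filter

/-! All operators in play commute with the charge, whose eigenspaces (the sectors) have dimension
min(M, μ) + 1. The symmetric space is thus a Hilbert sum of finite-dimensional sectors, on which the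
Hamiltonians act as bounded selfadjoint blocks. They are exponentiated block by block
(`IsBlockOp.isExp`), and in only one way (`IsExp.unique`). The charge generates a phase on each
sector, so block diagonal unitaries commute with it, and conversely
(`exists_block_of_mem_chargeGroup`).

Strong convergence of unitaries can be tested on the sectors, so the Lie theory of closed matrix
groups carries over: the families of skew blocks whose exponentials stay in 𝒢 form a real Lie
algebra (`add_mem_blockLie` by Trotter's formula, `bracket_mem_blockLie` by differentiating
conjugations). It contains the blocks of i H₁, i H₂, i H₃, hence those of everything they generate
(`exists_blockLie_of_inTcLie`).

What remains is linear algebra in one sector. In the basis of the unnormalised vectors `dicke k (μ -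
k)`, H₁ and H₃ are diagonal and affine in k, and H₂ is a raising matrix A plus a lowering matrix B.
Bracketing with H₁ separates A from B. The commutator [A, B] is diagonal, and its consecutive
differences are affine in k with slope -24, hence pairwise distinct. These weights isolate the
matrix units in A and B by Lagrange interpolation; brackets then give all off-diagonal units, and an
element of nonzero trace supplies what is left (`mem_of_ladder`, `lieMatrices_eq_top`).

This computes the complexification. If P + iQ is skew with P and Q skew, then Q = 0, so the real Lie
algebra already restricts to all skew operators (`exists_inTcLie_of_skew`). Every unitary of a
sector is the exponential of one of these, so 𝒢 realises it. -/

lemma mem_of_isClosed_strong {E : Type*} [NormedAddCommGroup E] [InnerProductSpace ℂ E]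
    {S : Set (E ≃ₗᵢ[ℂ] E)} (hS : IsClosed[strongTopology E] S)
    {α : Type*} {l : Filter α} [l.NeBot] {U : α → E ≃ₗᵢ[ℂ] E} {V : E ≃ₗᵢ[ℂ] E}
    (hU : ∀ a, U a ∈ S) (h : ∀ ψ, Tendsto (fun a => U a ψ) l (𝓝 (V ψ))) : V ∈ S := by
  let _ := strongTopology E
  refine IsClosed.mem_of_tendsto (f := U) (b := l) hS ?_ (Eventually.of_forall hU)
  rw [nhds_induced, tendsto_comap_iff]
  exact tendsto_pi_nhds.2 h

variable {E : Type*} [NormedAddCommGroup E] [InnerProductSpace ℂ E] [CompleteSpace E]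
  {ι : Type*} {C : ι → Type*} [∀ i, NormedAddCommGroup (C i)] [∀ i, InnerProductSpace ℂ (C i)]
  [∀ i, CompleteSpace (C i)] {J : ∀ i, C i →ₗᵢ[ℂ] E}

lemma isometry_mul_apply {E : Type*} [NormedAddCommGroup E] [InnerProductSpace ℂ E]
    (U V : E ≃ₗᵢ[ℂ] E) (ψ : E) : (U * V) ψ = U (V ψ) := rfl

lemma IsHilbertSum.iSup_range_dense (hJ : IsHilbertSum ℂ C J) :
    (⨆ i, LinearMap.range (J i).toLinearMap).topologicalClosure = ⊤ := by
  rw [← hJ.OrthogonalFamily.range_linearIsometry, LinearMap.range_eq_top]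
  exact hJ.surjective_isometry

/-- A closed subspace that contains all summands of a Hilbert sum is the whole space. -/
lemma IsHilbertSum.mem_of_isClosed (hJ : IsHilbertSum ℂ C J) {S : Submodule ℂ E}
    (hS : IsClosed (S : Set E)) (h : ∀ i x, J i x ∈ S) (ψ : E) : ψ ∈ S := by
  have h1 : (⨆ i, LinearMap.range (J i).toLinearMap) ≤ S :=
    iSup_le fun i => by rintro _ ⟨x, rfl⟩; exact h i x
  have h2 := Submodule.topologicalClosure_minimal _ h1 hS
  rw [IsHilbertSum.iSup_range_dense hJ] at h2
  exact h2 trivial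

/-- Twisting each inclusion by a unitary leaves its range unchanged. `blockU` is the passage from
the coordinates of the first decomposition to those of the second. -/
lemma IsHilbertSum.precomp (hJ : IsHilbertSum ℂ C J) (u : ∀ i, C i ≃ₗᵢ[ℂ] C i) :
    IsHilbertSum ℂ C fun i => (J i).comp (u i).toLinearIsometry := by
  refine IsHilbertSum.mk (fun i j hij x y => hJ.OrthogonalFamily hij (u i x) (u j y)) ?_
  have : ∀ i, LinearMap.range ((J i).comp (u i).toLinearIsometry).toLinearMap =
      LinearMap.range (J i).toLinearMap := by
    intro i
    ext y
    constructor
    · rintro ⟨x, rfl⟩; exact ⟨u i x, rfl⟩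
    · rintro ⟨x, rfl⟩; exact ⟨(u i).symm x, by simp⟩
  simp_rw [this, IsHilbertSum.iSup_range_dense hJ]
  exact le_rfl

/-- The unitary that acts on the `i`-th summand of a Hilbert sum as `u i`. -/
def blockU (hJ : IsHilbertSum ℂ C J) (u : ∀ i, C i ≃ₗᵢ[ℂ] C i) : E ≃ₗᵢ[ℂ] E :=
  hJ.linearIsometryEquiv.trans (IsHilbertSum.precomp hJ u).linearIsometryEquiv.symm

lemma blockU_apply (hJ : IsHilbertSum ℂ C J) (u : ∀ i, C i ≃ₗᵢ[ℂ] C i) (i : ι) (x : C i) :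
    blockU hJ u (J i x) = J i (u i x) := by
  classical
  have h : hJ.linearIsometryEquiv (J i x) = lp.single 2 i x := by
    rw [← hJ.linearIsometryEquiv_symm_apply_single x, LinearIsometryEquiv.apply_symm_apply]
  simp [blockU, h]

lemma isometry_ext (hJ : IsHilbertSum ℂ C J) {U V : E ≃ₗᵢ[ℂ] E}
    (h : ∀ i x, U (J i x) = V (J i x)) : U = V := by
  ext ψ
  refine IsHilbertSum.mem_of_isClosed hJ
    (S := LinearMap.eqLocus U.toLinearEquiv.toLinearMap V.toLinearEquiv.toLinearMap) ?_ h ψ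
  exact isClosed_eq U.continuous V.continuous

lemma blockU_mul (hJ : IsHilbertSum ℂ C J) (u v : ∀ i, C i ≃ₗᵢ[ℂ] C i) :
    blockU hJ (u * v) = blockU hJ u * blockU hJ v :=
  isometry_ext hJ fun i x => by
    rw [isometry_mul_apply, blockU_apply, blockU_apply, blockU_apply]; rfl

lemma blockU_one (hJ : IsHilbertSum ℂ C J) : blockU hJ 1 = 1 :=
  isometry_ext hJ fun i x => by rw [blockU_apply]; rfl

lemma blockU_pow (hJ : IsHilbertSum ℂ C J) (u : ∀ i, C i ≃ₗᵢ[ℂ] C i) (n : ℕ) :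
    blockU hJ (u ^ n) = blockU hJ u ^ n := by
  induction n with
  | zero => rw [pow_zero, pow_zero, blockU_one]
  | succ n ih => rw [pow_succ, pow_succ, blockU_mul, ih]

/-- Strong convergence of unitaries can be tested on the summands. -/
lemma tendsto_of_tendsto_block (hJ : IsHilbertSum ℂ C J) {α : Type*} {l : Filter α}
    {U : α → E ≃ₗᵢ[ℂ] E} {V : E ≃ₗᵢ[ℂ] E}
    (h : ∀ i x, Tendsto (fun a => U a (J i x)) l (𝓝 (V (J i x)))) (ψ : E) :
    Tendsto (fun a => U a ψ) l (𝓝 (V ψ)) := by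
  let S : Submodule ℂ E :=
    { carrier := {ψ | Tendsto (fun a => U a ψ) l (𝓝 (V ψ))}
      add_mem' := fun hx hy => by simpa using Tendsto.add hx hy
      zero_mem' := by simpa using tendsto_const_nhds
      smul_mem' := fun z x hx => by simpa using Tendsto.const_smul hx z }
  refine IsHilbertSum.mem_of_isClosed hJ (S := S) ?_ h ψ
  refine isClosed_of_closure_subset fun x hx => ?_
  change Tendsto (fun a => U a x) l (𝓝 (V x))
  -- An ε/3 argument: the set of vectors on which the limit holds is closed because all the maps are
  -- isometries.
  rw [Metric.tendsto_nhds]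
  intro ε hε
  obtain ⟨y, hy, hxy⟩ := Metric.mem_closure_iff.1 hx (ε / 3) (by positivity)
  have hy' : Tendsto (fun a => U a y) l (𝓝 (V y)) := hy
  filter_upwards [Metric.tendsto_nhds.1 hy' (ε / 3) (by positivity)] with a ha
  have h1 : dist (U a x) (U a y) < ε / 3 := by rwa [LinearIsometryEquiv.dist_map]
  have h2 : dist (V y) (V x) < ε / 3 := by rwa [LinearIsometryEquiv.dist_map, dist_comm]
  linarith [dist_triangle4 (U a x) (U a y) (V y) (V x)]

end Block

/-! ### Exponentials of skew-adjoint operators -/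

section Exp

open Filter

variable {H : Type*} [NormedAddCommGroup H] [InnerProductSpace ℂ H]

/-- Skew-adjointness of a bounded operator. -/
def IsSkew (a : H →L[ℂ] H) : Prop := ∀ x y, inner ℂ (a x) y = -inner ℂ x (a y)

lemma IsSkew.smul {a : H →L[ℂ] H} (h : IsSkew a) (r : ℝ) : IsSkew (r • a) := by
  intro x y
  simp only [smul_apply, inner_smul_left_eq_smul,
    inner_smul_right_eq_smul, h x y, smul_neg]

lemma IsSkew.add {a b : H →L[ℂ] H} (ha : IsSkew a) (hb : IsSkew b) : IsSkew (a + b) := by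
  intro x y
  simp only [add_apply, inner_add_left, inner_add_right, ha x y, hb x y]
  ring

lemma IsSkew.bracket {a b : H →L[ℂ] H} (ha : IsSkew a) (hb : IsSkew b) :
    IsSkew (a * b - b * a) := by
  intro x y
  simp only [sub_apply, mul_apply_eq_comp, inner_sub_left,
    inner_sub_right, ha _ y, hb _ y, ha x, hb x, neg_neg]
  ring

variable [CompleteSpace H]

lemma IsSkew.mem {a : H →L[ℂ] H} (h : IsSkew a) : a ∈ skewAdjoint (H →L[ℂ] H) := by
  rw [skewAdjoint.mem_iff, ContinuousLinearMap.star_eq_adjoint, eq_comm,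
    ContinuousLinearMap.eq_adjoint_iff]
  intro x y
  rw [neg_apply, inner_neg_left, h, neg_neg]

lemma IsSkew.of_mem {a : H →L[ℂ] H} (h : a ∈ skewAdjoint (H →L[ℂ] H)) : IsSkew a := by
  intro x y
  rw [skewAdjoint.mem_iff, ContinuousLinearMap.star_eq_adjoint] at h
  rw [← inner_neg_right, ← neg_apply, ← h, ContinuousLinearMap.adjoint_inner_right]

open Classical in
/-- The unitary `exp a` for skew-adjoint `a`. -/
def expSkew (a : H →L[ℂ] H) : H ≃ₗᵢ[ℂ] H :=
  if h : IsSkew a then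
    Unitary.linearIsometryEquiv ⟨NormedSpace.exp a,
      let _ : NormedAlgebra ℚ (H →L[ℂ] H) := .restrictScalars ℚ ℂ _
      NormedSpace.exp_mem_unitary_of_mem_skewAdjoint h.mem⟩
  -- The default value makes `expSkew` total, so that families of blocks can be written without
  -- carrying proofs of skewness.
  else 1

lemma expSkew_apply {a : H →L[ℂ] H} (h : IsSkew a) (x : H) :
    expSkew a x = NormedSpace.exp a x := by
  rw [expSkew, dif_pos h]; rfl

lemma expSkew_add {a b : H →L[ℂ] H} (ha : IsSkew a) (hb : IsSkew b) (h : Commute a b) :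
    expSkew (a + b) = expSkew a * expSkew b := by
  let _ : NormedAlgebra ℚ (H →L[ℂ] H) := .restrictScalars ℚ ℂ _
  ext x
  rw [isometry_mul_apply, expSkew_apply ha, expSkew_apply hb, expSkew_apply (ha.add hb),
    NormedSpace.exp_add_of_commute h]
  rfl

lemma expSkew_add_smul {a : H →L[ℂ] H} (ha : IsSkew a) (s t : ℝ) :
    expSkew ((s + t) • a) = expSkew (s • a) * expSkew (t • a) := by
  rw [add_smul, expSkew_add (ha.smul s) (ha.smul t)]
  exact ((Commute.refl a).smul_left s).smul_right t

lemma expSkew_zero : expSkew (0 : H →L[ℂ] H) = 1 := by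
  ext x
  rw [expSkew_apply fun x y => by simp]
  simp

lemma hasDerivAt_exp_apply (a : H →L[ℂ] H) (x : H) (t : ℝ) :
    HasDerivAt (fun s : ℝ => NormedSpace.exp (s • a) x) (NormedSpace.exp (t • a) (a x)) t :=
  ((ContinuousLinearMap.apply ℂ H x).restrictScalars ℝ).hasFDerivAt.comp_hasDerivAt t
    (hasDerivAt_exp_smul_const (𝕂 := ℝ) a t)

end Exp

/-! ### Trotter's formula, conjugation, and logarithms of unitaries. -/

section ExpLimits

open Filter

variable {H : Type*} [NormedAddCommGroup H] [InnerProductSpace ℂ H]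

/-- Telescoping: each of the n factors costs at most ‖a - b‖. The norm of 1 is only assumed to be at
most 1, since it vanishes for operators on the zero space. -/
lemma norm_pow_sub_pow_le {R : Type*} [NormedRing R] {a b : R} (ha : ‖a‖ ≤ 1) (hb : ‖b‖ ≤ 1)
    (hone : ‖(1 : R)‖ ≤ 1) (n : ℕ) : ‖a ^ n - b ^ n‖ ≤ n * ‖a - b‖ := by
  induction n with
  | zero => simp
  | succ n ih =>
    have h1 : a ^ (n + 1) - b ^ (n + 1) = a ^ n * (a - b) + (a ^ n - b ^ n) * b := by
      rw [pow_succ, pow_succ]; noncomm_ring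
    have h2 : ‖a ^ n‖ ≤ 1 := by
      clear ih h1
      induction n with
      | zero => simpa using hone
      | succ n ih =>
        rw [pow_succ]
        exact (norm_mul_le _ _).trans (mul_le_one₀ ih (norm_nonneg _) ha)
    have h3 : ‖a ^ n * (a - b)‖ ≤ 1 * ‖a - b‖ :=
      (norm_mul_le _ _).trans (mul_le_mul_of_nonneg_right h2 (norm_nonneg _))
    have h4 : ‖(a ^ n - b ^ n) * b‖ ≤ ‖a ^ n - b ^ n‖ * 1 :=
      (norm_mul_le _ _).trans (mul_le_mul_of_nonneg_left hb (norm_nonneg _))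
    rw [h1]
    push_cast
    linarith [norm_add_le (a ^ n * (a - b)) ((a ^ n - b ^ n) * b)]

lemma tendsto_inv_succ : Tendsto (fun n : ℕ => ((n : ℝ) + 1)⁻¹) atTop (𝓝[≠] 0) := by
  rw [tendsto_nhdsWithin_iff]
  refine ⟨by simpa using tendsto_one_div_add_atTop_nhds_zero_nat (𝕜 := ℝ), ?_⟩
  exact Eventually.of_forall fun n => by
    have : (0 : ℝ) < n + 1 := by positivity
    simpa using this.ne'

/-- The derivative at 0 along the steps 1/(n+1). Both limits that make a Lie algebra out of a closed
group, Trotter products and brackets, have this form. -/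
lemma tendsto_succ_smul {R : Type*} [NormedAddCommGroup R] [NormedSpace ℝ R] {f : ℝ → R} {f' : R}
    (h : HasDerivAt f f' 0) :
    Tendsto (fun n : ℕ => ((n : ℝ) + 1) • (f ((n : ℝ) + 1)⁻¹ - f 0)) atTop (𝓝 f') := by
  have := h.tendsto_slope_zero.comp tendsto_inv_succ
  simpa [Function.comp_def] using this

lemma IsSkew.neg {a : H →L[ℂ] H} (h : IsSkew a) : IsSkew (-a) := by
  intro x y
  rw [neg_apply, neg_apply, inner_neg_left, inner_neg_right, h x y]

lemma IsSkew.of_tendsto {a : ℕ → H →L[ℂ] H} {b : H →L[ℂ] H} (ha : ∀ n, IsSkew (a n))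
    (h : Tendsto a atTop (𝓝 b)) : IsSkew b := by
  intro x y
  have h1 : ∀ z, Tendsto (fun n => a n z) atTop (𝓝 (b z)) := fun z =>
    ((ContinuousLinearMap.apply ℂ H z).continuous.tendsto b).comp h
  refine tendsto_nhds_unique ((h1 x).inner (tendsto_const_nhds (x := y))) ?_
  simp_rw [ha _ x y]
  exact (tendsto_const_nhds.inner (h1 y)).neg

variable [CompleteSpace H]

lemma IsSkew.norm_exp_le {a : H →L[ℂ] H} (h : IsSkew a) : ‖NormedSpace.exp a‖ ≤ 1 :=
  ContinuousLinearMap.opNorm_le_bound _ zero_le_one fun x => by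
    rw [← expSkew_apply h, LinearIsometryEquiv.norm_map, one_mul]

/-- The Trotter product formula for bounded skew-adjoint operators. -/
lemma tendsto_trotter {a b : H →L[ℂ] H} (ha : IsSkew a) (hb : IsSkew b) :
    Tendsto (fun n : ℕ => (NormedSpace.exp (((n : ℝ) + 1)⁻¹ • a) *
      NormedSpace.exp (((n : ℝ) + 1)⁻¹ • b)) ^ (n + 1)) atTop (𝓝 (NormedSpace.exp (a + b))) := by
  let _ : NormedAlgebra ℚ (H →L[ℂ] H) := .restrictScalars ℚ ℂ _
  -- The two curves agree to first order at 0, so n + 1 times their distance at 1/(n+1) tends to 0.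
  -- This is the bound that `norm_pow_sub_pow_le` gives for the powers.
  have hd : HasDerivAt (fun s : ℝ => NormedSpace.exp (s • a) * NormedSpace.exp (s • b) -
      NormedSpace.exp (s • (a + b))) 0 0 := by
    have := ((hasDerivAt_exp_smul_const (𝕂 := ℝ) a 0).mul
      (hasDerivAt_exp_smul_const (𝕂 := ℝ) b 0)).sub
      (hasDerivAt_exp_smul_const (𝕂 := ℝ) (a + b) 0)
    simp only [zero_smul, NormedSpace.exp_zero, one_mul, mul_one, sub_self] at this
    exact this
  have h := (tendsto_succ_smul hd).norm
  simp only [zero_smul, NormedSpace.exp_zero, mul_one, sub_self, sub_zero, norm_zero] at h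
  rw [tendsto_iff_norm_sub_tendsto_zero]
  refine squeeze_zero (fun _ => norm_nonneg _) (fun n => ?_) h
  have hpos : (0 : ℝ) < n + 1 := by positivity
  have hexp : NormedSpace.exp (a + b) =
      NormedSpace.exp (((n : ℝ) + 1)⁻¹ • (a + b)) ^ (n + 1) := by
    rw [← NormedSpace.exp_nsmul, ← Nat.cast_smul_eq_nsmul ℝ, smul_smul]
    push_cast
    rw [mul_inv_cancel₀ hpos.ne', one_smul]
  rw [hexp, norm_smul, Real.norm_of_nonneg hpos.le]
  have := norm_pow_sub_pow_le
    (a := NormedSpace.exp (((n : ℝ) + 1)⁻¹ • a) * NormedSpace.exp (((n : ℝ) + 1)⁻¹ • b))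
    (b := NormedSpace.exp (((n : ℝ) + 1)⁻¹ • (a + b)))
    ((norm_mul_le _ _).trans (mul_le_one₀ (ha.smul _).norm_exp_le (norm_nonneg _)
      (hb.smul _).norm_exp_le)) ((ha.add hb).smul _).norm_exp_le
      ContinuousLinearMap.norm_id_le (n + 1)
  simpa using this

/-- Conjugation of `b` by `exp (s a)`. -/
def expConj (a b : H →L[ℂ] H) (s : ℝ) : H →L[ℂ] H :=
  NormedSpace.exp (s • a) * b * NormedSpace.exp (s • -a)

lemma exp_smul_mul_exp_neg (a : H →L[ℂ] H) (s : ℝ) :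
    NormedSpace.exp (s • a) * NormedSpace.exp (s • -a) = 1 := by
  let _ : NormedAlgebra ℚ (H →L[ℂ] H) := .restrictScalars ℚ ℂ _
  rw [← NormedSpace.exp_add_of_commute, ← smul_add, add_neg_cancel, smul_zero,
    NormedSpace.exp_zero]
  exact (((Commute.refl a).neg_right).smul_left s).smul_right s

lemma inner_exp_left {a : H →L[ℂ] H} (ha : IsSkew a) (s : ℝ) (x y : H) :
    inner ℂ (NormedSpace.exp (s • a) x) y = inner ℂ x (NormedSpace.exp (s • -a) y) := by
  have h : y = NormedSpace.exp (s • a) (NormedSpace.exp (s • -a) y) :=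
    (congrArg (fun f : H →L[ℂ] H => f y) (exp_smul_mul_exp_neg a s)).symm
  rw [← expSkew_apply (ha.smul s)] at h ⊢
  conv_lhs => rw [h]
  rw [LinearIsometryEquiv.inner_map_map]

lemma IsSkew.expConj {a b : H →L[ℂ] H} (ha : IsSkew a) (hb : IsSkew b) (s : ℝ) :
    IsSkew (expConj a b s) := by
  intro x y
  have h := inner_exp_left ha.neg s x
  rw [neg_neg] at h
  simp only [TavisCummings.expConj, mul_apply_eq_comp]
  rw [inner_exp_left ha, hb, h]

/-- Conjugation commutes with the exponential, so the one-parameter group of a conjugate is a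
conjugate inside the group. -/
lemma expSkew_expConj {a b : H →L[ℂ] H} (ha : IsSkew a) (hb : IsSkew b) (s t : ℝ) :
    expSkew (t • expConj a b s) = expSkew (s • a) * expSkew (t • b) * expSkew (s • -a) := by
  let _ : NormedAlgebra ℚ (H →L[ℂ] H) := .restrictScalars ℚ ℂ _
  have h' := exp_smul_mul_exp_neg (-a) s
  rw [neg_neg] at h'
  have h := NormedSpace.exp_units_conj
    (⟨NormedSpace.exp (s • a), NormedSpace.exp (s • -a), exp_smul_mul_exp_neg a s, h'⟩ :
      (H →L[ℂ] H)ˣ) (t • b)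
  ext x
  rw [isometry_mul_apply, isometry_mul_apply, expSkew_apply ((ha.expConj hb s).smul t),
    expSkew_apply (ha.smul s), expSkew_apply (hb.smul t), expSkew_apply (ha.neg.smul s)]
  have h2 : t • expConj a b s = NormedSpace.exp (s • a) * (t • b) * NormedSpace.exp (s • -a) := by
    rw [expConj, mul_smul_comm, smul_mul_assoc]
  rw [h2]
  exact congrArg (fun f : H →L[ℂ] H => f x) h

/-- This is how the bracket arises as a limit of elements already known to be in `blockLie`. -/
lemma hasDerivAt_expConj (a b : H →L[ℂ] H) : HasDerivAt (expConj a b) (a * b - b * a) 0 := by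
  let _ : NormedAlgebra ℚ (H →L[ℂ] H) := .restrictScalars ℚ ℂ _
  have := ((hasDerivAt_exp_smul_const (𝕂 := ℝ) a 0).mul_const b).mul
    (hasDerivAt_exp_smul_const (𝕂 := ℝ) (-a) 0)
  simp only [zero_smul, NormedSpace.exp_zero, one_mul, mul_one, mul_neg, ← sub_eq_add_neg] at this
  exact this

/-- Every unitary of a finite-dimensional space is the exponential of a skew-adjoint operator. -/
lemma exists_expSkew_eq [FiniteDimensional ℂ H] (u : H ≃ₗᵢ[ℂ] H) :
    ∃ a : H →L[ℂ] H, IsSkew a ∧ expSkew a = u := by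
  let v : unitary (H →L[ℂ] H) := Unitary.linearIsometryEquiv.symm u
  have hfin : (spectrum ℂ (v : H →L[ℂ] H)).Finite := by
    have h1 := AlgEquiv.spectrum_eq (Module.End.toContinuousLinearMap (𝕜 := ℂ) H)
      ((v : H →L[ℂ] H) : H →ₗ[ℂ] H)
    have h2 : Module.End.toContinuousLinearMap (𝕜 := ℂ) H ((v : H →L[ℂ] H) : H →ₗ[ℂ] H) =
      (v : H →L[ℂ] H) := rfl
    rw [h2] at h1
    rw [h1]
    exact Module.End.finite_spectrum _
  -- The argument is discontinuous on the circle, but the spectrum is finite, so the functional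
  -- calculus still applies.
  let f : ℂ → ℂ := fun z => Complex.I * z.arg
  have hf : ContinuousOn f (spectrum ℂ (v : H →L[ℂ] H)) := hfin.continuousOn f
  have hv : IsStarNormal (v : H →L[ℂ] H) := inferInstance
  let a : H →L[ℂ] H := cfc f (v : H →L[ℂ] H)
  have ha : IsSkew a := by
    refine IsSkew.of_mem ?_
    rw [skewAdjoint.mem_iff, ← cfc_star, ← cfc_neg]
    congr 1
    funext z
    simp [f]
  refine ⟨a, ha, ?_⟩
  ext x
  have hexp : NormedSpace.exp a = (v : H →L[ℂ] H) := by
    rw [← CFC.exp_eq_normedSpace_exp (𝕜 := ℂ) (cfc_predicate f _),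
      ← cfc_comp' (hg := by fun_prop)]
    conv_rhs => rw [← cfc_id' ℂ (v : H →L[ℂ] H)]
    refine cfc_congr fun y hy => ?_
    have hy1 : ‖y‖ = 1 := spectrum.norm_eq_one_of_unitary v.2 hy
    rw [← Complex.exp_eq_exp_ℂ]
    simp only [f]
    rw [mul_comm]
    have := Complex.norm_mul_exp_arg_mul_I y
    rwa [hy1, Complex.ofReal_one, one_mul] at this
  rw [expSkew_apply ha, hexp]
  rfl

end ExpLimits

/-! ### The Lie algebra of a strongly closed group of unitaries. -/

section LieOfGroup

open Filter

variable {E : Type*} [NormedAddCommGroup E] [InnerProductSpace ℂ E] [CompleteSpace E]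
  {ι : Type*} {C : ι → Type*} [∀ i, NormedAddCommGroup (C i)] [∀ i, InnerProductSpace ℂ (C i)]
  [∀ i, CompleteSpace (C i)] {J : ∀ i, C i →ₗᵢ[ℂ] E}

/-- The families of skew-adjoint blocks whose exponentials lie in the group `G`. -/
def blockLie (hJ : IsHilbertSum ℂ C J) (G : Subgroup (E ≃ₗᵢ[ℂ] E)) :
    Set (∀ i, C i →L[ℂ] C i) :=
  {T | (∀ i, IsSkew (T i)) ∧ ∀ t : ℝ, blockU hJ (fun i => expSkew (t • T i)) ∈ G}

variable {hJ : IsHilbertSum ℂ C J} {G : Subgroup (E ≃ₗᵢ[ℂ] E)}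

lemma zero_mem_blockLie : (0 : ∀ i, C i →L[ℂ] C i) ∈ blockLie hJ G := by
  refine ⟨fun i x y => by simp, fun t => ?_⟩
  have : (fun i => expSkew (t • (0 : ∀ i, C i →L[ℂ] C i) i)) = 1 := by
    funext i; rw [Pi.zero_apply, smul_zero, expSkew_zero]; rfl
  rw [this, blockU_one]
  exact G.one_mem

lemma smul_mem_blockLie {T : ∀ i, C i →L[ℂ] C i} (hT : T ∈ blockLie hJ G) (r : ℝ) :
    (fun i => r • T i) ∈ blockLie hJ G := by
  refine ⟨fun i => (hT.1 i).smul r, fun t => ?_⟩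
  simp_rw [smul_smul]
  exact hT.2 (t * r)

/-- No uniformity over the blocks is needed, since strong limits can be tested on one summand at a
time. -/
lemma mem_blockLie_of_tendsto (hG : IsClosed[strongTopology E] (G : Set (E ≃ₗᵢ[ℂ] E)))
    {T : ℕ → ∀ i, C i →L[ℂ] C i} {S : ∀ i, C i →L[ℂ] C i} (hT : ∀ n, T n ∈ blockLie hJ G)
    (h : ∀ i, Tendsto (fun n => T n i) atTop (𝓝 (S i))) : S ∈ blockLie hJ G := by
  have hS : ∀ i, IsSkew (S i) := fun i => IsSkew.of_tendsto (fun n => (hT n).1 i) (h i)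
  refine ⟨hS, fun t => ?_⟩
  refine mem_of_isClosed_strong hG (l := atTop) (fun n => (hT n).2 t)
    (tendsto_of_tendsto_block hJ fun i x => ?_)
  simp_rw [blockU_apply]
  refine ((J i).continuous.tendsto _).comp ?_
  rw [expSkew_apply ((hS i).smul t)]
  simp_rw [fun n => expSkew_apply (((hT n).1 i).smul t)]
  let _ : NormedAlgebra ℚ (C i →L[ℂ] C i) := .restrictScalars ℚ ℂ _
  exact ((ContinuousLinearMap.apply ℂ (C i) x).continuous.tendsto _).comp
    ((NormedSpace.exp_continuous.tendsto _).comp ((h i).const_smul t))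

lemma add_mem_blockLie (hG : IsClosed[strongTopology E] (G : Set (E ≃ₗᵢ[ℂ] E)))
    {S T : ∀ i, C i →L[ℂ] C i} (hS : S ∈ blockLie hJ G) (hT : T ∈ blockLie hJ G) :
    (fun i => S i + T i) ∈ blockLie hJ G := by
  refine ⟨fun i => (hS.1 i).add (hT.1 i), fun t => ?_⟩
  -- One Trotter factor with step t/(n+1), formed in all blocks at once so that its powers remain in
  -- the group.
  let U : ℕ → ∀ i, C i ≃ₗᵢ[ℂ] C i := fun n i =>
    expSkew (((n : ℝ) + 1)⁻¹ • t • S i) * expSkew (((n : ℝ) + 1)⁻¹ • t • T i)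
  have hU : ∀ n, blockU hJ (U n ^ (n + 1)) ∈ G := fun n => by
    rw [blockU_pow]
    refine G.pow_mem ?_ _
    have := G.mul_mem (hS.2 (((n : ℝ) + 1)⁻¹ * t)) (hT.2 (((n : ℝ) + 1)⁻¹ * t))
    rw [← blockU_mul] at this
    simp only [mul_smul] at this
    exact this
  refine mem_of_isClosed_strong hG (l := atTop) hU (tendsto_of_tendsto_block hJ fun i x => ?_)
  simp_rw [blockU_apply]
  refine ((J i).continuous.tendsto _).comp ?_
  have h1 := (hS.1 i).smul t
  have h2 := (hT.1 i).smul t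
  have hpow : ∀ n m : ℕ, ∀ y, (U n ^ m) i y = ((NormedSpace.exp (((n : ℝ) + 1)⁻¹ • t • S i) *
      NormedSpace.exp (((n : ℝ) + 1)⁻¹ • t • T i)) ^ m) y := by
    intro n m
    induction m with
    | zero => intro y; rfl
    | succ m ih =>
      intro y
      rw [pow_succ, pow_succ, Pi.mul_apply, isometry_mul_apply, ih, isometry_mul_apply,
        expSkew_apply (h1.smul _), expSkew_apply (h2.smul _)]
      rfl
  simp_rw [hpow]
  rw [smul_add, expSkew_apply (h1.add h2)]
  exact ((ContinuousLinearMap.apply ℂ (C i) x).continuous.tendsto _).comp (tendsto_trotter h1 h2)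

lemma expConj_mem_blockLie {S T : ∀ i, C i →L[ℂ] C i} (hS : S ∈ blockLie hJ G)
    (hT : T ∈ blockLie hJ G) (s : ℝ) : (fun i => expConj (S i) (T i) s) ∈ blockLie hJ G := by
  refine ⟨fun i => (hS.1 i).expConj (hT.1 i) s, fun t => ?_⟩
  simp_rw [fun i => expSkew_expConj (hS.1 i) (hT.1 i) s t]
  have h := G.mul_mem (G.mul_mem (hS.2 s) (hT.2 t)) (hS.2 (-s))
  rw [← blockU_mul, ← blockU_mul] at h
  simp only [neg_smul, ← smul_neg] at h
  exact h

lemma bracket_mem_blockLie (hG : IsClosed[strongTopology E] (G : Set (E ≃ₗᵢ[ℂ] E)))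
    {S T : ∀ i, C i →L[ℂ] C i} (hS : S ∈ blockLie hJ G) (hT : T ∈ blockLie hJ G) :
    (fun i => S i * T i - T i * S i) ∈ blockLie hJ G := by
  -- Difference quotients of the conjugation are real combinations of conjugates, and they converge
  -- to the bracket.
  refine mem_blockLie_of_tendsto hG
    (T := fun n i => ((n : ℝ) + 1) • (expConj (S i) (T i) ((n : ℝ) + 1)⁻¹ -
      expConj (S i) (T i) 0)) (fun n => ?_) fun i => tendsto_succ_smul (hasDerivAt_expConj _ _)
  refine smul_mem_blockLie ?_ _
  have := add_mem_blockLie hG (expConj_mem_blockLie hS hT ((n : ℝ) + 1)⁻¹)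
    (smul_mem_blockLie (expConj_mem_blockLie hS hT 0) (-1))
  simpa only [neg_smul, one_smul, ← sub_eq_add_neg] using this

end LieOfGroup

/-! ### Uniqueness of the exponential of a symmetric operator. -/

section OneParameter

open Filter

variable {E : Type*} [NormedAddCommGroup E] [InnerProductSpace ℂ E] {A : E →ₗ.[ℂ] E}
  {W W' : ℝ → (E ≃ₗᵢ[ℂ] E)}

lemma hasDerivAt_isometry (U : E ≃ₗᵢ[ℂ] E) {f : ℝ → E} {f' : E} {t : ℝ} (h : HasDerivAt f f' t) :
    HasDerivAt (fun s => U (f s)) (U f') t :=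
  ((U.toContinuousLinearEquiv : E →L[ℂ] E).restrictScalars ℝ).hasFDerivAt.comp_hasDerivAt t h

lemma hasDerivAt_of_add (hadd : ∀ s t, W (s + t) = W s * W t) {ψ φ : E}
    (h : HasDerivAt (fun t => W t ψ) φ 0) (t : ℝ) : HasDerivAt (fun s => W s ψ) (W t φ) t := by
  have h1 : (fun s => W s ψ) = fun s => W t (W (s - t) ψ) := by
    funext s
    rw [← isometry_mul_apply, ← hadd, add_sub_cancel]
  rw [h1]
  refine hasDerivAt_isometry (W t) (HasDerivAt.comp_sub_const (f := fun s => W s ψ) t t ?_)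
  rwa [sub_self]

/-- A one-parameter group commutes with itself, hence with its generator. -/
lemma IsExp.mem_closure (h : IsExp A W) {ψ φ : E} (hψ : (ψ, φ) ∈ A.graph.topologicalClosure)
    (t : ℝ) : (W t ψ, W t φ) ∈ A.graph.topologicalClosure := by
  rw [← h.gen] at hψ ⊢
  have h1 : (fun s => W s (W t ψ)) = fun s => W t (W s ψ) := by
    funext s
    rw [← isometry_mul_apply, ← isometry_mul_apply, ← h.add, ← h.add, add_comm]
  rw [h1, ← map_smul]
  exact hasDerivAt_isometry (W t) hψ

lemma inner_closure_graph (hA : ∀ x ∈ A.graph, ∀ y ∈ A.graph, inner ℂ x.1 y.2 = inner ℂ x.2 y.1)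
    {x y : E × E} (hx : x ∈ A.graph.topologicalClosure) (hy : y ∈ A.graph.topologicalClosure) :
    inner ℂ x.1 y.2 = inner ℂ x.2 y.1 := by
  have h1 : ∀ y ∈ A.graph, inner ℂ x.1 y.2 = inner ℂ x.2 y.1 := fun y hy =>
    closure_minimal (s := (A.graph : Set (E × E)))
      (t := {x : E × E | inner ℂ x.1 y.2 = inner ℂ x.2 y.1})
      (fun x hx => hA x hx y hy) (isClosed_eq (by fun_prop) (by fun_prop)) hx
  exact closure_minimal (s := (A.graph : Set (E × E)))
    (t := {y : E × E | inner ℂ x.1 y.2 = inner ℂ x.2 y.1})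
    h1 (isClosed_eq (by fun_prop) (by fun_prop)) hy

/-- Expanding ‖Uψ - Vψ‖² leaves 2‖ψ‖² minus twice the real part of ⟨Uψ, Vψ⟩. -/
lemma norm_isometry_sub_eq_zero (U V : E ≃ₗᵢ[ℂ] E) {ψ : E}
    (h : inner ℂ (U ψ) (V ψ) = inner ℂ ψ ψ) : U ψ = V ψ := by
  rw [← sub_eq_zero, ← inner_self_eq_zero (𝕜 := ℂ), inner_sub_left, inner_sub_right,
    inner_sub_right, LinearIsometryEquiv.inner_map_map, LinearIsometryEquiv.inner_map_map, h,
    ← inner_conj_symm (V ψ), h, inner_conj_symm]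
  ring

/-- A densely defined symmetric operator has at most one exponential. -/
theorem IsExp.unique
    (hA : ∀ x ∈ A.graph, ∀ y ∈ A.graph, inner ℂ x.1 y.2 = inner ℂ x.2 y.1)
    (hd : A.domain.topologicalClosure = ⊤) (h : IsExp A W) (h' : IsExp A W') : W = W' := by
  have key : ∀ t, ∀ ψ ∈ A.domain, W t ψ = W' t ψ := by
    intro t ψ hψ
    apply norm_isometry_sub_eq_zero
    have hg : (ψ, A ⟨ψ, hψ⟩) ∈ A.graph.topologicalClosure :=
      Submodule.le_topologicalClosure _ (A.mem_graph ⟨ψ, hψ⟩)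
    have h0 : ∀ {V : ℝ → (E ≃ₗᵢ[ℂ] E)}, IsExp A V → V 0 = 1 := fun hV => by
      have := hV.add 0 0
      rwa [add_zero, left_eq_mul] at this
    -- The inner product of the two orbits is constant because the two terms of its derivative
    -- cancel by symmetry of the closure; at time 0 it is ⟨ψ, ψ⟩.
    have hder : ∀ s, HasDerivAt (fun s => inner ℂ (W s ψ) (W' s ψ)) 0 s := by
      intro s
      have h1 := hasDerivAt_of_add h.add ((h.gen _ _).2 hg) s
      have h2 := hasDerivAt_of_add h'.add ((h'.gen _ _).2 hg) s
      have h3 := h1.inner ℂ h2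
      have h4 := inner_closure_graph hA (h.mem_closure hg s) (h'.mem_closure hg s)
      simp only [map_smul, inner_smul_left, inner_smul_right] at h3
      rw [h4, Complex.conj_I, neg_mul, add_neg_cancel] at h3
      exact h3
    have hc := is_const_of_deriv_eq_zero (fun s => (hder s).differentiableAt)
      (fun s => (hder s).deriv) t 0
    rw [hc, h0 h, h0 h']
    rfl
  funext t
  ext ψ
  have hψ : ψ ∈ closure (A.domain : Set E) := by
    have : ψ ∈ A.domain.topologicalClosure := hd ▸ trivial
    exact this
  exact closure_minimal (t := {ψ | W t ψ = W' t ψ}) (key t)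
    (isClosed_eq (W t).continuous (W' t).continuous) hψ

end OneParameter

/-! ### Block diagonal operators and their exponentials. -/

section BlockOperator

open Filter

variable {E : Type*} [NormedAddCommGroup E] [InnerProductSpace ℂ E] [CompleteSpace E]
  {ι : Type*} {C : ι → Type*} [∀ i, NormedAddCommGroup (C i)] [∀ i, InnerProductSpace ℂ (C i)]
  [∀ i, CompleteSpace (C i)] {J : ∀ i, C i →ₗᵢ[ℂ] E}

/-- `A` is the symmetric block operator with blocks `a i`, defined on the algebraic sum of the
summands. -/
structure IsBlockOp (J : ∀ i, C i →ₗᵢ[ℂ] E) (A : E →ₗ.[ℂ] E) (a : ∀ i, C i →L[ℂ] C i) : Prop where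
  skew : ∀ i, IsSkew (Complex.I • a i)
  dom : A.domain = ⨆ i, LinearMap.range (J i).toLinearMap
  graph : ∀ i x, (J i x, J i (a i x)) ∈ A.graph

variable {A : E →ₗ.[ℂ] E} {a : ∀ i, C i →L[ℂ] C i}

/-- The span of the graphs of the blocks lies in the graph and projects onto the whole domain, so it
is the graph. Linear conditions on the graph therefore need checking on single blocks only. -/
lemma IsBlockOp.graph_le (hA : IsBlockOp J A a) {S : Submodule ℂ (E × E)}
    (hS : ∀ i x, (J i x, J i (a i x)) ∈ S) : A.graph ≤ S := by
  let R : Submodule ℂ (E × E) := ⨆ i, LinearMap.range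
    ((J i).toLinearMap.prod ((J i).toLinearMap ∘ₗ (a i).toLinearMap))
  have hRS : R ≤ S := iSup_le fun i => by rintro _ ⟨x, rfl⟩; exact hS i x
  have hRA : R ≤ A.graph := iSup_le fun i => by rintro _ ⟨x, rfl⟩; exact hA.graph i x
  have hdom : A.domain ≤ R.map (LinearMap.fst ℂ E E) := by
    rw [hA.dom]
    refine iSup_le fun i => ?_
    rintro _ ⟨x, rfl⟩
    exact ⟨(J i x, J i (a i x)), Submodule.mem_iSup_of_mem i ⟨x, rfl⟩, rfl⟩
  rintro ⟨ψ, φ⟩ hx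
  obtain ⟨⟨y, z⟩, hyR, hy⟩ := hdom (A.mem_domain_of_mem_graph hx)
  obtain rfl : y = ψ := hy
  obtain rfl : z = φ := A.mem_graph_snd_inj (hRA hyR) hx rfl
  exact hRS hyR

lemma IsBlockOp.inner_block (hA : IsBlockOp J A a) (i : ι) (x y : C i) :
    inner ℂ (a i x) y = inner ℂ x (a i y) := by
  have := hA.skew i x y
  simp only [smul_apply, inner_smul_left, inner_smul_right, Complex.conj_I, neg_mul,
    neg_inj, mul_eq_mul_left_iff, Complex.I_ne_zero, or_false] at this
  exact this

lemma IsBlockOp.symm (hJ : IsHilbertSum ℂ C J) (hA : IsBlockOp J A a) :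
    ∀ x ∈ A.graph, ∀ y ∈ A.graph, inner ℂ x.1 y.2 = inner ℂ x.2 y.1 := by
  let S (x : E × E) : Submodule ℂ (E × E) :=
    { carrier := {y | inner ℂ x.1 y.2 = inner ℂ x.2 y.1}
      add_mem' := fun hy hz => by
        simp only [Set.mem_ofPred_eq, Prod.fst_add, Prod.snd_add, inner_add_right] at *
        rw [hy, hz]
      zero_mem' := by simp
      smul_mem' := fun c y hy => by
        simp only [Set.mem_ofPred_eq, Prod.smul_fst, Prod.smul_snd, inner_smul_right] at *
        rw [hy] }
  have hS : ∀ x y, y ∈ S x → x ∈ S y := fun x y h => by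
    have h : inner ℂ x.1 y.2 = inner ℂ x.2 y.1 := h
    change inner ℂ y.1 x.2 = inner ℂ y.2 x.1
    rw [← inner_conj_symm, ← h, inner_conj_symm]
  have h1 : ∀ i x, A.graph ≤ S (J i x, J i (a i x)) := by
    refine fun i x => hA.graph_le fun j y => ?_
    change inner ℂ (J i x) (J j (a j y)) = inner ℂ (J i (a i x)) (J j y)
    rcases eq_or_ne i j with rfl | hij
    · rw [LinearIsometry.inner_map_map, LinearIsometry.inner_map_map, hA.inner_block]
    · rw [hJ.OrthogonalFamily hij, hJ.OrthogonalFamily hij]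
  intro x hx y hy
  exact (hA.graph_le (S := S x) fun i z => hS _ _ (h1 i z hx)) hy

lemma IsBlockOp.dense (hJ : IsHilbertSum ℂ C J) (hA : IsBlockOp J A a) :
    A.domain.topologicalClosure = ⊤ := by
  rw [hA.dom, IsHilbertSum.iSup_range_dense hJ]

lemma hasDerivAt_blockU (hJ : IsHilbertSum ℂ C J) {T : ∀ i, C i →L[ℂ] C i}
    (hT : ∀ i, IsSkew (T i)) (i : ι) (x : C i) (t : ℝ) :
    HasDerivAt (fun s : ℝ => blockU hJ (fun i => expSkew (s • T i)) (J i x))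
      (blockU hJ (fun i => expSkew (t • T i)) (J i (T i x))) t := by
  simp_rw [blockU_apply, fun s : ℝ => expSkew_apply ((hT i).smul s)]
  exact ((J i).toContinuousLinearMap.restrictScalars ℝ).hasFDerivAt.comp_hasDerivAt t
    (hasDerivAt_exp_apply (T i) x t)

/-- The pairs `(ψ, φ)` for which `φ` generates the orbit of `ψ` form a closed subspace. -/
lemma hasDerivAt_orbit_of_mem_closure {W : ℝ → (E ≃ₗᵢ[ℂ] E)} {S : Submodule ℂ (E × E)}
    (hS : ∀ x ∈ S, ∀ t, HasDerivAt (fun s => W s x.1) (W t (Complex.I • x.2)) t)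
    {x : E × E} (hx : x ∈ S.topologicalClosure) (t : ℝ) :
    HasDerivAt (fun s => W s x.1) (W t (Complex.I • x.2)) t := by
  obtain ⟨y, hy, hlim⟩ := mem_closure_iff_seq_limit.1 hx
  have h1 : Tendsto (fun n => (y n).1) atTop (𝓝 x.1) := (continuous_fst.tendsto x).comp hlim
  have h2 : Tendsto (fun n => (y n).2) atTop (𝓝 x.2) := (continuous_snd.tendsto x).comp hlim
  -- The unitaries preserve distances, so convergence of the second components makes the derivatives
  -- converge uniformly in time.
  refine hasDerivAt_of_tendstoUniformly (l := atTop) (f := fun n s => W s (y n).1)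
    (f' := fun n s => W s (Complex.I • (y n).2)) (g' := fun s => W s (Complex.I • x.2)) ?_
    (Eventually.of_forall fun n s => hS _ (hy n) s)
    (fun s => ((W s).continuous.tendsto _).comp h1) t
  rw [Metric.tendstoUniformly_iff]
  intro ε hε
  filter_upwards [Metric.tendsto_nhds.1 (h2.const_smul Complex.I) ε hε] with n hn s
  rwa [LinearIsometryEquiv.dist_map, dist_comm]

lemma hasSum_block (hJ : IsHilbertSum ℂ C J) (ψ : E) :
    HasSum (fun i => J i (hJ.linearIsometryEquiv ψ i)) ψ := by
  simpa using hJ.hasSum_linearIsometryEquiv_symm (hJ.linearIsometryEquiv ψ)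

lemma inner_block_coord (hJ : IsHilbertSum ℂ C J) (i : ι) (x : C i) (ψ : E) :
    inner ℂ (J i x) ψ = inner ℂ x (hJ.linearIsometryEquiv ψ i) := by
  classical
  rw [← hJ.linearIsometryEquiv_symm_apply_single x, ← hJ.linearIsometryEquiv.inner_map_map,
    LinearIsometryEquiv.apply_symm_apply, lp.inner_single_left]

/-- This is essential selfadjointness: the adjoint relation forces the coordinates of φ to be the
blocks applied to those of ψ, and the finite partial sums of the pair then lie in the graph. -/
lemma IsBlockOp.mem_closure_graph (hJ : IsHilbertSum ℂ C J) (hA : IsBlockOp J A a) {ψ φ : E}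
    (h : ∀ i x, inner ℂ (J i x) φ = inner ℂ (J i (a i x)) ψ) :
    (ψ, φ) ∈ A.graph.topologicalClosure := by
  have hc : ∀ i, hJ.linearIsometryEquiv φ i = a i (hJ.linearIsometryEquiv ψ i) := by
    intro i
    refine ext_inner_left ℂ fun x => ?_
    rw [← inner_block_coord, h, inner_block_coord, hA.inner_block]
  have hsum := (hasSum_block hJ ψ).prodMk (hasSum_block hJ φ)
  refine mem_closure_of_tendsto hsum (Eventually.of_forall fun s => ?_)
  refine A.graph.sum_mem fun i _ => ?_
  rw [hc]
  exact hA.graph i _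

/-- A symmetric block operator has an exponential, which is given by the exponentials of its
blocks. -/
theorem IsBlockOp.isExp (hJ : IsHilbertSum ℂ C J) (hA : IsBlockOp J A a) :
    IsExp A fun t => blockU hJ fun i => expSkew (t • Complex.I • a i) := by
  have hadd : ∀ s t : ℝ, blockU hJ (fun i => expSkew ((s + t) • Complex.I • a i)) =
      blockU hJ (fun i => expSkew (s • Complex.I • a i)) *
        blockU hJ fun i => expSkew (t • Complex.I • a i) := fun s t => by
    rw [← blockU_mul]
    congr 1
    funext i
    exact expSkew_add_smul (hA.skew i) s t
  refine ⟨hadd, ?_, fun ψ φ => ⟨fun h => ?_, fun h => ?_⟩⟩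
  · intro ψ
    rw [continuous_iff_continuousAt]
    intro t
    exact tendsto_of_tendsto_block hJ
      (fun i x => (hasDerivAt_blockU hJ hA.skew i x t).continuousAt.tendsto) ψ
  -- The inner product of the orbits of J i x and ψ is constant; its derivative at 0 is the adjoint
  -- relation.
  · refine hA.mem_closure_graph hJ fun i x => ?_
    have h1 := (hasDerivAt_blockU hJ hA.skew i x 0).inner ℂ h
    have h2 : (fun s : ℝ => inner ℂ (blockU hJ (fun i => expSkew (s • Complex.I • a i)) (J i x))
        (blockU hJ (fun i => expSkew (s • Complex.I • a i)) ψ)) = fun _ => inner ℂ (J i x) ψ := by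
      funext s
      rw [LinearIsometryEquiv.inner_map_map]
    rw [h2] at h1
    have h3 := h1.unique (hasDerivAt_const 0 _)
    have h4 : blockU hJ (fun i => expSkew ((0 : ℝ) • Complex.I • a i)) = 1 := by
      rw [← blockU_one hJ]
      congr 1
      funext i
      rw [zero_smul, expSkew_zero]; rfl
    rw [h4] at h3
    change inner ℂ (J i x) (Complex.I • φ) + inner ℂ (J i (Complex.I • a i x)) ψ = 0 at h3
    rw [map_smul, inner_smul_left, inner_smul_right, Complex.conj_I, neg_mul,
      ← sub_eq_add_neg, sub_eq_zero] at h3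
    exact mul_left_cancel₀ Complex.I_ne_zero h3
  · let W : ℝ → (E ≃ₗᵢ[ℂ] E) := fun t => blockU hJ fun i => expSkew (t • Complex.I • a i)
    let S : Submodule ℂ (E × E) :=
      { carrier := {x | ∀ t, HasDerivAt (fun s => W s x.1) (W t (Complex.I • x.2)) t}
        add_mem' := fun hx hy t => by simpa using (hx t).fun_add (hy t)
        zero_mem' := fun t => by simpa using hasDerivAt_const t (0 : E)
        smul_mem' := fun c x hx t => by
          simpa [smul_comm Complex.I c] using (hx t).fun_const_smul c }
    have hS : A.graph ≤ S := hA.graph_le fun i x t => by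
      have := hasDerivAt_blockU hJ hA.skew i x t
      rw [smul_apply, map_smul] at this
      exact this
    have := hasDerivAt_orbit_of_mem_closure (W := W) (S := A.graph) (fun x hx => hS hx) h 0
    have h4 : W 0 = 1 := by
      have := hadd 0 0
      rwa [add_zero, left_eq_mul] at this
    rw [h4] at this
    exact this

end BlockOperator

/-! ### The dynamical group and the unitaries that commute with the charge. -/

section Groups

open Filter

variable {E : Type*} [NormedAddCommGroup E] [InnerProductSpace ℂ E]

lemma isClosed_dynamicalGroup {κ : Type*} (H : κ → (E →ₗ.[ℂ] E)) :
    IsClosed[strongTopology E] (dynamicalGroup H : Set (E ≃ₗᵢ[ℂ] E)) := by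
  let _ := strongTopology E
  rw [dynamicalGroup, Subgroup.coe_sInf]
  exact isClosed_biInter fun S hS => hS.1

lemma mem_dynamicalGroup {κ : Type*} {H : κ → (E →ₗ.[ℂ] E)} {k : κ} {W : ℝ → (E ≃ₗᵢ[ℂ] E)}
    (h : IsExp (H k) W) (t : ℝ) : W t ∈ dynamicalGroup H :=
  Subgroup.mem_sInf.2 fun _ hS => hS.2 k W h t

/-- The dynamical group is smallest only among strongly closed subgroups, so comparing it with
`chargeGroup` requires this. -/
lemma isClosed_chargeGroup (X : E →ₗ.[ℂ] E) :
    IsClosed[strongTopology E] (chargeGroup X : Set (E ≃ₗᵢ[ℂ] E)) := by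
  let _ := strongTopology E
  have hev : ∀ ψ : E, Continuous fun U : E ≃ₗᵢ[ℂ] E => U ψ := fun ψ =>
    (continuous_apply ψ).comp continuous_induced_dom
  have : (chargeGroup X : Set (E ≃ₗᵢ[ℂ] E)) =
      ⋂ P ∈ {P | ∃ W, IsExp X W ∧ ∃ α, P = W α}, ⋂ ψ : E, {U | P (U ψ) = U (P ψ)} := by
    ext U
    simp only [chargeGroup, SetLike.mem_coe, Subgroup.mem_centralizer_iff, Set.mem_iInter]
    refine forall₂_congr fun P _ => ⟨fun h ψ => ?_, fun h => ?_⟩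
    · exact congrArg (fun f : E ≃ₗᵢ[ℂ] E => f ψ) h
    · ext ψ; exact h ψ
  rw [this]
  exact isClosed_biInter fun P _ => isClosed_iInter fun ψ =>
    isClosed_eq (P.continuous.comp (hev ψ)) (hev (P ψ))

variable [CompleteSpace E]
  {ι : Type*} {C : ι → Type*} [∀ i, NormedAddCommGroup (C i)] [∀ i, InnerProductSpace ℂ (C i)]
  [∀ i, CompleteSpace (C i)] {J : ∀ i, C i →ₗᵢ[ℂ] E} (hJ : IsHilbertSum ℂ C J)

include hJ

/-- `dynamicalGroup` and `chargeGroup` quantify over every W with `IsExp`; this reduces them to the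
explicit one. -/
lemma IsBlockOp.eq_of_isExp {A : E →ₗ.[ℂ] E} {a : ∀ i, C i →L[ℂ] C i} (hA : IsBlockOp J A a)
    {W : ℝ → (E ≃ₗᵢ[ℂ] E)} (h : IsExp A W) :
    W = fun t => blockU hJ fun i => expSkew (t • Complex.I • a i) :=
  h.unique (hA.symm hJ) (hA.dense hJ) (hA.isExp hJ)

lemma mem_blockLie_dynamicalGroup {κ : Type*} {H : κ → (E →ₗ.[ℂ] E)} {k : κ}
    {a : ∀ i, C i →L[ℂ] C i} (hA : IsBlockOp J (H k) a) :
    (fun i => Complex.I • a i) ∈ blockLie hJ (dynamicalGroup H) :=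
  ⟨hA.skew, mem_dynamicalGroup (hA.isExp hJ)⟩

variable {X : E →ₗ.[ℂ] E} {c : ι → ℝ}

lemma IsBlockOp.charge_apply (hX : IsBlockOp J X fun i => (c i : ℂ) • 1) {W : ℝ → (E ≃ₗᵢ[ℂ] E)}
    (h : IsExp X W) (t : ℝ) : ∃ z : ι → ℂ, ∀ i x, W t (J i x) = z i • J i x := by
  refine ⟨fun i => NormedSpace.exp ((t : ℂ) * (Complex.I * c i)), fun i x => ?_⟩
  rw [hX.eq_of_isExp hJ h, blockU_apply, expSkew_apply ((hX.skew i).smul t)]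
  have : t • Complex.I • (c i : ℂ) • (1 : C i →L[ℂ] C i) =
      algebraMap ℂ (C i →L[ℂ] C i) ((t : ℂ) * (Complex.I * c i)) := by
    rw [Algebra.algebraMap_eq_smul_one, mul_smul, mul_smul]
    rfl
  rw [this, ← NormedSpace.algebraMap_exp_comm, Algebra.algebraMap_eq_smul_one]
  simp

lemma blockU_mem_chargeGroup (hX : IsBlockOp J X fun i => (c i : ℂ) • 1)
    (u : ∀ i, C i ≃ₗᵢ[ℂ] C i) : blockU hJ u ∈ chargeGroup X := by
  rw [chargeGroup, Subgroup.mem_centralizer_iff]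
  rintro P ⟨W, hW, t, rfl⟩
  obtain ⟨z, hz⟩ := hX.charge_apply hJ hW t
  refine isometry_ext hJ fun i x => ?_
  rw [isometry_mul_apply, isometry_mul_apply, blockU_apply, hz, hz, map_smul, blockU_apply]

lemma dynamicalGroup_le_chargeGroup (hX : IsBlockOp J X fun i => (c i : ℂ) • 1) {κ : Type*}
    {H : κ → (E →ₗ.[ℂ] E)} {a : κ → ∀ i, C i →L[ℂ] C i} (hH : ∀ k, IsBlockOp J (H k) (a k)) :
    dynamicalGroup H ≤ chargeGroup X := by
  refine sInf_le ⟨isClosed_chargeGroup X, fun k W hW t => ?_⟩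
  rw [(hH k).eq_of_isExp hJ hW]
  exact blockU_mem_chargeGroup hJ hX _

/-- Unitaries that commute with the charge are block diagonal. -/
lemma exists_block_of_mem_chargeGroup [∀ i, FiniteDimensional ℂ (C i)]
    (hX : IsBlockOp J X fun i => (c i : ℂ) • 1) (hc : Function.Injective c)
    {V : E ≃ₗᵢ[ℂ] E} (hV : V ∈ chargeGroup X) (i : ι) :
    ∃ v : C i ≃ₗᵢ[ℂ] C i, ∀ x, V (J i x) = J i (v x) := by
  have hW := hX.isExp hJ
  set W : ℝ → (E ≃ₗᵢ[ℂ] E) := fun t => blockU hJ fun i => expSkew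
    (t • Complex.I • (c i : ℂ) • (1 : C i →L[ℂ] C i)) with hWdef
  have hgr : ∀ j y, (J j y, (c j : ℂ) • J j y) ∈ X.graph.topologicalClosure := fun j y => by
    have := Submodule.le_topologicalClosure _ (hX.graph j y)
    rwa [smul_apply, map_smul] at this
  -- V carries eigenvectors of the closed charge to eigenvectors of the same eigenvalue, and these
  -- are orthogonal to every other sector.
  have horth : ∀ x j, j ≠ i → ∀ y, inner ℂ (J j y) (V (J i x)) = 0 := by
    intro x j hji y
    have h1 : HasDerivAt (fun t => W t (V (J i x))) (Complex.I • (c i : ℂ) • V (J i x)) 0 := by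
      have h2 := hasDerivAt_isometry V ((hW.gen _ _).2 (hgr i x))
      have h3 : (fun t => W t (V (J i x))) = fun t => V (W t (J i x)) := by
        funext t
        rw [chargeGroup, Subgroup.mem_centralizer_iff] at hV
        exact congrArg (fun f : E ≃ₗᵢ[ℂ] E => f (J i x)) (hV (W t) ⟨W, hW, t, rfl⟩)
      rw [h3]
      simpa only [map_smul] using h2
    have h4 := inner_closure_graph (hX.symm hJ) (hgr j y) ((hW.gen _ _).1 h1)
    simp only [inner_smul_left, inner_smul_right, Complex.conj_ofReal] at h4
    rw [← sub_eq_zero, ← sub_mul, mul_eq_zero, sub_eq_zero, Complex.ofReal_inj] at h4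
    exact h4.resolve_left fun h => hji (hc h).symm
  have hcoord : ∀ x, V (J i x) = J i (hJ.linearIsometryEquiv (V (J i x)) i) := by
    intro x
    refine (hasSum_block hJ (V (J i x))).unique (hasSum_single i fun j hj => ?_)
    have : hJ.linearIsometryEquiv (V (J i x)) j = 0 := by
      refine ext_inner_left ℂ fun y => ?_
      rw [← inner_block_coord, horth x j hj y, inner_zero_right]
    rw [this, map_zero]
  let L : C i →ₗᵢ[ℂ] C i :=
    { toFun := fun x => hJ.linearIsometryEquiv (V (J i x)) i
      map_add' := fun x y => by simp
      map_smul' := fun z x => by simp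
      norm_map' := fun x => by
        change ‖hJ.linearIsometryEquiv (V (J i x)) i‖ = ‖x‖
        rw [← (J i).norm_map, ← hcoord, V.norm_map, (J i).norm_map] }
  -- An isometry of a finite-dimensional space into itself is onto.
  exact ⟨L.toLinearIsometryEquiv rfl, hcoord⟩

end Groups

/-! ### Lie algebras of matrices that contain a ladder. -/

section MatrixLie

open Matrix

variable {m : Type*} [Fintype m] [DecidableEq m] {L : Submodule ℂ (Matrix m m ℂ)}
  (hL : ∀ S ∈ L, ∀ T ∈ L, S * T - T * S ∈ L)

lemma lie_diagonal_apply (g : m → ℂ) (T : Matrix m m ℂ) (i j : m) :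
    (diagonal g * T - T * diagonal g) i j = (g i - g j) * T i j := by
  rw [Matrix.sub_apply, diagonal_mul, mul_diagonal]
  ring

include hL in
/-- Entrywise multiplication by a polynomial in the weights of a diagonal element. -/
lemma eval_weight_mem {g : m → ℂ} (hg : diagonal g ∈ L) {T : Matrix m m ℂ} (hT : T ∈ L)
    (p : Polynomial ℂ) : Matrix.of (fun i j => p.eval (g i - g j) * T i j) ∈ L := by
  induction p using Polynomial.induction_on' with
  | add p q hp hq =>
    convert L.add_mem hp hq using 1
    ext i j
    simp [add_mul]
  | monomial k z =>
    induction k with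
    | zero =>
      convert L.smul_mem z hT using 1
      ext i j
      simp
    | succ k ih =>
      convert hL _ hg _ ih using 1
      ext i j
      rw [lie_diagonal_apply]
      simp only [of_apply, Polynomial.eval_monomial]
      ring

include hL in
/-- If all nonzero entries of an element have distinct weights under a diagonal element, then the
corresponding matrix units belong to the Lie algebra. -/
lemma single_mem_of_weight {g : m → ℂ} (hg : diagonal g ∈ L) {T : Matrix m m ℂ} (hT : T ∈ L)
    {i j : m} (hij : T i j ≠ 0)
    (hinj : ∀ k l, T k l ≠ 0 → g k - g l = g i - g j → k = i ∧ l = j) :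
    Matrix.single i j 1 ∈ L := by
  classical
  let s : Finset ℂ := (Finset.univ.filter fun x : m × m => T x.1 x.2 ≠ 0).image
    fun x => g x.1 - g x.2
  have hs : ∀ k l, T k l ≠ 0 → g k - g l ∈ s := fun k l h =>
    Finset.mem_image.2 ⟨(k, l), by simpa using h, rfl⟩
  -- The Lagrange polynomial is 1 at the weight of the entry (i, j) and 0 at the weights of all
  -- other nonzero entries.
  have h := L.smul_mem (T i j)⁻¹ (eval_weight_mem hL hg hT (Lagrange.basis s id (g i - g j)))
  convert h using 1
  ext k l
  simp only [Matrix.smul_apply, of_apply, smul_eq_mul, single_apply]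
  by_cases hkl : T k l = 0
  · rw [hkl, mul_zero, mul_zero, if_neg]
    rintro ⟨rfl, rfl⟩
    exact hij hkl
  · by_cases he : g k - g l = g i - g j
    · obtain ⟨rfl, rfl⟩ := hinj k l hkl he
      have := Lagrange.eval_basis_self (s := s) (v := id) (i := g k - g l)
        (Function.injective_id.injOn) (hs k l hkl)
      rw [id] at this
      rw [this, if_pos ⟨rfl, rfl⟩, one_mul, inv_mul_cancel₀ hkl]
    · have := Lagrange.eval_basis_of_ne (s := s) (v := id) (i := g i - g j) (j := g k - g l)
        (Ne.symm he) (hs k l hkl)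
      rw [id] at this
      rw [this, zero_mul, mul_zero, if_neg]
      rintro ⟨rfl, rfl⟩
      exact he rfl

include hL in
lemma single_mem_trans {i j k : m} (hik : i ≠ k) (h1 : Matrix.single i j 1 ∈ L)
    (h2 : Matrix.single j k 1 ∈ L) : Matrix.single i k 1 ∈ L := by
  have h := hL _ h1 _ h2
  rw [single_mul_single_same,
    single_mul_single_of_ne (h := hik.symm), sub_zero, one_mul] at h
  exact h

include hL in
/-- The off-diagonal matrix units and an element of nonzero trace generate everything. -/
lemma eq_top_of_single_mem (h : ∀ i j, i ≠ j → Matrix.single i j 1 ∈ L) {T : Matrix m m ℂ}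
    (hT : T ∈ L) (htr : T.trace ≠ 0) (S : Matrix m m ℂ) : S ∈ L := by
  have hd : ∀ i j, Matrix.single i i 1 - Matrix.single j j 1 ∈ L := by
    intro i j
    rcases eq_or_ne i j with rfl | hij
    · rw [sub_self]; exact L.zero_mem
    · have := hL _ (h i j hij) _ (h j i hij.symm)
      rwa [single_mul_single_same, single_mul_single_same, one_mul] at this
  -- Modulo the off-diagonal units and the differences of diagonal ones, a matrix is its trace times
  -- one diagonal unit.
  have hred : ∀ (S : Matrix m m ℂ) (k : m), S - S.trace • Matrix.single k k 1 ∈ L := by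
    intro S k
    have h1 : S - S.trace • Matrix.single k k 1 = ∑ i, ∑ j, S i j •
        (if i = j then Matrix.single i i 1 - Matrix.single k k 1 else Matrix.single i j 1) := by
      rw [Matrix.trace, Finset.sum_smul]
      conv_lhs => enter [1]; rw [matrix_eq_sum_single S]
      rw [← Finset.sum_sub_distrib]
      refine Finset.sum_congr rfl fun i _ => ?_
      have h2 : S.diag i • Matrix.single k k (1 : ℂ) =
          ∑ j, if i = j then S i j • Matrix.single k k 1 else 0 := by simp
      rw [h2, ← Finset.sum_sub_distrib]
      refine Finset.sum_congr rfl fun j _ => ?_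
      rcases eq_or_ne i j with rfl | hij
      · rw [if_pos rfl, if_pos rfl, smul_sub, smul_single _ i i, smul_eq_mul, mul_one]
      · rw [if_neg hij, if_neg hij, smul_single, smul_eq_mul, mul_one, sub_zero]
    rw [h1]
    refine L.sum_mem fun i _ => L.sum_mem fun j _ =>
      L.smul_mem _ ?_
    split_ifs with hij
    · exact hd i k
    · exact h i j hij
  by_cases hm : Nonempty m
  · obtain ⟨k⟩ := hm
    have hk : Matrix.single k k 1 ∈ L := by
      have h1 := L.smul_mem T.trace⁻¹ (L.sub_mem hT (hred T k))
      rwa [sub_sub_cancel, smul_smul, inv_mul_cancel₀ htr, one_smul] at h1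
    have h2 := L.add_mem (hred S k) (L.smul_mem S.trace hk)
    rwa [sub_add_cancel] at h2
  · have := not_nonempty_iff.1 hm
    rw [Subsingleton.elim S 0]
    exact L.zero_mem

/-- A Lie algebra of matrices that contains a diagonal matrix with entries of nonzero constant
difference, the sum of a raising matrix `A` and a lowering matrix `B` with the commutator
`diagonal g` where `g` has injective differences, and a matrix of nonzero trace, is everything. -/
theorem mem_of_ladder {n : ℕ} {L : Submodule ℂ (Matrix (Fin (n + 1)) (Fin (n + 1)) ℂ)}
    (hL : ∀ S ∈ L, ∀ T ∈ L, S * T - T * S ∈ L)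
    {A B T : Matrix (Fin (n + 1)) (Fin (n + 1)) ℂ} {a b : ℂ} (ha : a ≠ 0) {α β g : ℕ → ℂ}
    (hA : ∀ i j : Fin (n + 1), A i j = if (i : ℕ) = j + 1 then α j else 0)
    (hB : ∀ i j : Fin (n + 1), B i j = if (j : ℕ) = i + 1 then β i else 0)
    (hAB : A * B - B * A = diagonal fun i : Fin (n + 1) => g i)
    (hα : ∀ k < n, α k ≠ 0) (hβ : ∀ k < n, β k ≠ 0)
    (hg : ∀ k l : ℕ, g (k + 1) - g k = g (l + 1) - g l → k = l)
    (hK : (diagonal fun i : Fin (n + 1) => a * (i : ℕ) + b) ∈ L) (hABL : A + B ∈ L)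
    (hT : T ∈ L) (htr : T.trace ≠ 0) (S : Matrix (Fin (n + 1)) (Fin (n + 1)) ℂ) : S ∈ L := by
  -- The diagonal entries change by a in each step, so the bracket multiplies A by a and B by -a.
  have hsub : A - B ∈ L := by
    have h := L.smul_mem a⁻¹ (hL _ hK _ hABL)
    convert h using 1
    ext i j
    rw [Matrix.smul_apply, lie_diagonal_apply, Matrix.sub_apply, Matrix.add_apply, hA, hB,
      smul_eq_mul]
    split_ifs with h1 h2 h2
    · omega
    · rw [h1]; push_cast; field_simp; ring
    · rw [h2]; push_cast; field_simp; ring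
    · simp
  have hAL : A ∈ L := by
    have h := L.smul_mem (1 / 2 : ℂ) (L.add_mem hABL hsub)
    convert h using 1
    rw [add_add_sub_cancel, ← two_smul ℂ A, smul_smul]; norm_num
  have hBL : B ∈ L := by
    have h := L.sub_mem hABL hAL
    rwa [add_sub_cancel_left] at h
  have hD : (diagonal fun i : Fin (n + 1) => g i) ∈ L := by
    rw [← hAB]
    exact hL _ hAL _ hBL
  have hup : ∀ k (hk : k < n),
      Matrix.single (⟨k + 1, by omega⟩ : Fin (n + 1)) ⟨k, by omega⟩ 1 ∈ L := by
    intro k hk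
    refine single_mem_of_weight hL hD hAL (by rw [hA, if_pos rfl]; exact hα k hk) ?_
    intro i j hij he
    rw [hA] at hij
    have h1 : (i : ℕ) = j + 1 := by by_contra h; simp [h] at hij
    have h2 : (j : ℕ) = k := hg _ _ (by simpa [h1] using he)
    constructor <;> ext <;> simp <;> omega
  have hdown : ∀ k (hk : k < n),
      Matrix.single (⟨k, by omega⟩ : Fin (n + 1)) ⟨k + 1, by omega⟩ 1 ∈ L := by
    intro k hk
    refine single_mem_of_weight hL hD hBL (by rw [hB, if_pos rfl]; exact hβ k hk) ?_
    intro i j hij he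
    rw [hB] at hij
    have h1 : (j : ℕ) = i + 1 := by by_contra h; simp [h] at hij
    have h2 : (i : ℕ) = k := hg _ _ (by
      rw [← neg_inj, neg_sub, neg_sub]
      simpa [h1] using he)
    constructor <;> ext <;> simp <;> omega
  -- Equality is allowed as an alternative because the diagonal units are not yet available; this
  -- makes the relation transitive, and every index gets linked to 0.
  have htrans : ∀ i j k : Fin (n + 1), (i = j ∨ Matrix.single i j 1 ∈ L) →
      (j = k ∨ Matrix.single j k 1 ∈ L) → (i = k ∨ Matrix.single i k 1 ∈ L) := by
    rintro i j k (rfl | h1) (rfl | h2)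
    · exact Or.inl rfl
    · exact Or.inr h2
    · exact Or.inr h1
    · by_cases hik : i = k
      · exact Or.inl hik
      · exact Or.inr (single_mem_trans hL hik h1 h2)
  have hzero : ∀ k (hk : k < n + 1),
      ((⟨k, hk⟩ : Fin (n + 1)) = 0 ∨ Matrix.single (⟨k, hk⟩ : Fin (n + 1)) 0 1 ∈ L) ∧
      (0 = (⟨k, hk⟩ : Fin (n + 1)) ∨ Matrix.single 0 (⟨k, hk⟩ : Fin (n + 1)) 1 ∈ L) := by
    intro k
    induction k with
    | zero => exact fun _ => ⟨Or.inl rfl, Or.inl rfl⟩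
    | succ k ih =>
      intro hk
      obtain ⟨h1, h2⟩ := ih (by omega)
      exact ⟨htrans _ _ _ (Or.inr (hup k (by omega))) h1,
        htrans _ _ _ h2 (Or.inr (hdown k (by omega)))⟩
  refine eq_top_of_single_mem hL (fun i j hij => ?_) hT htr S
  exact (htrans i 0 j (hzero i i.2).1 (hzero j j.2).2).resolve_left hij

end MatrixLie

/-! ### Collective operators in terms of the number of excited atoms. -/

section Weights

variable {M : ℕ}

/-- The number of excited atoms. -/
def weight (b : Config M) : ℕ := (Finset.univ.filter fun i => b i = 1).card

lemma weight_le (b : Config M) : weight b ≤ M :=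
  (Finset.card_filter_le _ _).trans (by simp)

lemma weight_comp (b : Config M) (σ : Equiv.Perm (Fin M)) : weight (b ∘ σ) = weight b :=
  Finset.card_bij (fun i _ => σ i) (by simp) (by simp) fun i hi =>
    ⟨σ.symm i, by simpa using hi, by simp⟩

/-- The permutations act transitively on the configurations of a given weight, so a symmetric vector
is a function of the weight. -/
lemma exists_perm_of_weight_eq {b c : Config M} (h : weight b = weight c) :
    ∃ σ : Equiv.Perm (Fin M), c ∘ σ = b := by
  have h1 : Fintype.card {i // b i = 1} = Fintype.card {i // c i = 1} := by
    rw [Fintype.card_subtype, Fintype.card_subtype]; exact h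
  have h2 : Fintype.card {i // ¬b i = 1} = Fintype.card {i // ¬c i = 1} := by
    rw [Fintype.card_subtype_compl, Fintype.card_subtype_compl, h1]
  let f := Fintype.equivOfCardEq h1
  let g := Fintype.equivOfCardEq h2
  refine ⟨Equiv.subtypeCongr f g, funext fun i => ?_⟩
  have hne : ∀ x : Fin 2, ¬x = 1 → x = 0 := by decide
  by_cases hi : b i = 1
  · have : Equiv.subtypeCongr f g i = f ⟨i, hi⟩ := by simp [Equiv.subtypeCongr, hi]
    rw [Function.comp_apply, this, (f ⟨i, hi⟩).2, hi]
  · have : Equiv.subtypeCongr f g i = g ⟨i, hi⟩ := by simp [Equiv.subtypeCongr, hi]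
    rw [Function.comp_apply, this, hne _ (g ⟨i, hi⟩).2, hne _ hi]

lemma exists_weight_eq {k : ℕ} (hk : k ≤ M) : ∃ b : Config M, weight b = k := by
  refine ⟨fun i => if (i : ℕ) < k then 1 else 0, ?_⟩
  simp only [weight, ite_eq_left_iff, zero_ne_one, imp_false, not_not]
  rw [Fin.card_filter_val_lt, min_eq_right hk]

lemma weight_update_zero {b : Config M} {j : Fin M} (hj : b j = 1) :
    weight (Function.update b j 0) = weight b - 1 := by
  have : (Finset.univ.filter fun i => Function.update b j 0 i = 1) =
      (Finset.univ.filter fun i => b i = 1).erase j := by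
    ext i
    rcases eq_or_ne i j with rfl | h <;> simp [*]
  rw [weight, this, Finset.card_erase_of_mem (by simpa using hj)]
  rfl

lemma weight_update_one {b : Config M} {j : Fin M} (hj : b j = 0) :
    weight (Function.update b j 1) = weight b + 1 := by
  have : (Finset.univ.filter fun i => Function.update b j 1 i = 1) =
      insert j (Finset.univ.filter fun i => b i = 1) := by
    ext i
    rcases eq_or_ne i j with rfl | h <;> simp [*]
  rw [weight, this, Finset.card_insert_of_notMem (by simp [hj])]
  rfl

lemma sum_eq_weight {V : Type*} [AddCommGroup V] [Module ℂ V] (b : Config M) (x y : V) :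
    ∑ j, (if b j = 1 then x else y) = (weight b : ℂ) • x + ((M : ℂ) - weight b) • y := by
  have hc : (Finset.univ.filter fun i => ¬b i = 1).card = M - weight b := by
    have := Finset.card_filter_add_card_filter_not (s := (Finset.univ : Finset (Fin M)))
      (fun i => b i = 1)
    rw [Finset.card_univ, Fintype.card_fin] at this
    rw [weight]
    omega
  rw [Finset.sum_ite, Finset.sum_const, Finset.sum_const, hc, ← Nat.cast_sub (weight_le b),
    Nat.cast_smul_eq_nsmul, Nat.cast_smul_eq_nsmul]
  rfl

/-- Row b only meets the configurations that agree with b away from atom j. -/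
lemma sum_atomOp {V : Type*} [AddCommGroup V] [Module ℂ V] (A : Matrix (Fin 2) (Fin 2) ℂ)
    (j : Fin M) (b : Config M) (f : Config M → V) :
    ∑ c, atomOp A j b c • f c = ∑ v, A (b j) v • f (Function.update b j v) := by
  have hinj : Function.Injective fun v : Fin 2 => Function.update b j v :=
    Function.update_injective b j
  have himg : ∑ v, A (b j) v • f (Function.update b j v) =
      ∑ c ∈ Finset.univ.image fun v : Fin 2 => Function.update b j v, A (b j) (c j) • f c := by
    rw [Finset.sum_image hinj.injOn]
    simp
  rw [himg]
  symm
  rw [← Finset.sum_subset (Finset.subset_univ _)]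
  · refine Finset.sum_congr rfl fun c hc => ?_
    obtain ⟨v, -, rfl⟩ := Finset.mem_image.1 hc
    rw [atomOp, Matrix.of_apply, if_pos]
    intro i hi
    rw [Function.update_of_ne hi]
  · intro c _ hc
    rw [atomOp, Matrix.of_apply, if_neg, zero_smul]
    intro h
    refine hc (Finset.mem_image.2 ⟨c j, Finset.mem_univ _, ?_⟩)
    funext i
    rcases eq_or_ne i j with rfl | hi
    · simp
    · simp [hi, h i hi]

/-- Each excited atom contributes row 1 of A and each unexcited one row 0. The truncation in `weight
b - 1` is harmless, since at weight 0 its coefficient vanishes. -/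
lemma sum_collective {V : Type*} [AddCommGroup V] [Module ℂ V] (A : Matrix (Fin 2) (Fin 2) ℂ)
    (b : Config M) (f : ℕ → V) :
    ∑ c, collective M A b c • f (weight c) =
      (weight b : ℂ) • (A 1 0 • f (weight b - 1) + A 1 1 • f (weight b)) +
      ((M : ℂ) - weight b) • (A 0 0 • f (weight b) + A 0 1 • f (weight b + 1)) := by
  have h1 : ∑ c, collective M A b c • f (weight c) =
      ∑ j, ∑ c, atomOp A j b c • f (weight c) := by
    rw [Finset.sum_comm]
    refine Finset.sum_congr rfl fun c _ => ?_
    rw [collective, Matrix.sum_apply, Finset.sum_smul]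
  rw [h1, ← sum_eq_weight b]
  refine Finset.sum_congr rfl fun j _ => ?_
  rw [sum_atomOp A j b fun c => f (weight c), Fin.sum_univ_two]
  have hne : ∀ x : Fin 2, ¬x = 1 → x = 0 := by decide
  split_ifs with hj
  · have h3 : Function.update b j 1 = b := by rw [← hj, Function.update_eq_self]
    rw [weight_update_zero hj, h3, hj]
  · have hj := hne _ hj
    have h3 : Function.update b j 0 = b := by rw [← hj, Function.update_eq_self]
    rw [weight_update_one hj, h3, hj]

lemma atomOp_conjTranspose (A : Matrix (Fin 2) (Fin 2) ℂ) (j : Fin M) :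
    (atomOp A j).conjTranspose = atomOp A.conjTranspose j := by
  ext b c
  simp only [Matrix.conjTranspose_apply, atomOp, Matrix.of_apply, apply_ite star, star_zero,
    eq_comm (a := c _)]

lemma collective_conjTranspose (A : Matrix (Fin 2) (Fin 2) ℂ) :
    (collective M A).conjTranspose = collective M A.conjTranspose := by
  rw [collective, Matrix.conjTranspose_sum]
  simp_rw [atomOp_conjTranspose]
  rfl

lemma pauliPlus_eq : pauliPlus = !![0, 0; 2, 0] := by
  ext i j
  fin_cases i <;> fin_cases j <;> simp [pauliPlus, pauli1, pauli2]
  norm_num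

lemma pauliMinus_eq : pauliMinus = !![0, 2; 0, 0] := by
  ext i j
  fin_cases i <;> fin_cases j <;> simp [pauliMinus, pauli1, pauli2]
  norm_num

lemma pauli3_conjTranspose : pauli3.conjTranspose = pauli3 := by
  ext i j
  fin_cases i <;> fin_cases j <;> simp [pauli3]

lemma pauliPlus_conjTranspose : pauliPlus.conjTranspose = pauliMinus := by
  rw [pauliPlus_eq, pauliMinus_eq]
  ext i j
  fin_cases i <;> fin_cases j <;> simp

end Weights

/-! ### The mode operators on number states. -/

section ModeOperators

variable {F : Type*} [NormedAddCommGroup F] [InnerProductSpace ℂ F] (e : HilbertBasis ℕ ℂ F)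

lemma coe_modeBasis (n : ℕ) : (modeBasis e n : F) = e n := by
  exact congrArg Subtype.val (Module.Basis.span_apply e.orthonormal.linearIndependent n)

lemma annihilation_basis (n : ℕ) :
    annihilation e (modeBasis e n) = ((Real.sqrt n : ℝ) : ℂ) • modeBasis e (n - 1) := by
  rw [annihilation, Module.Basis.constr_basis]

lemma creation_basis (n : ℕ) :
    creation e (modeBasis e n) = ((Real.sqrt (n + 1) : ℝ) : ℂ) • modeBasis e (n + 1) := by
  rw [creation, Module.Basis.constr_basis]

lemma number_basis (n : ℕ) : number e (modeBasis e n) = (n : ℂ) • modeBasis e n := by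
  rw [number, Module.End.mul_apply, annihilation_basis, map_smul, creation_basis]
  cases n with
  | zero => simp
  | succ n =>
    rw [Nat.add_sub_cancel, smul_smul, ← Complex.ofReal_mul]
    push_cast
    rw [← Complex.ofReal_mul, Real.mul_self_sqrt (by positivity)]
    push_cast
    rfl

lemma inner_mode_ext {S T : Module.End ℂ (modeDomain e)}
    (h : ∀ m n, inner ℂ (S (modeBasis e m)) (modeBasis e n) =
      inner ℂ (modeBasis e m) (T (modeBasis e n))) (x y : modeDomain e) :
    inner ℂ (S x) y = inner ℂ x (T y) := by
  have hx := (modeBasis e).linearCombination_repr x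
  have hy := (modeBasis e).linearCombination_repr y
  rw [← hx, ← hy, Finsupp.linearCombination_apply, Finsupp.linearCombination_apply,
    Finsupp.sum, Finsupp.sum]
  simp only [map_sum, map_smul, sum_inner, inner_sum, inner_smul_left, inner_smul_right, h]

lemma inner_modeBasis (m n : ℕ) :
    inner ℂ (modeBasis e m) (modeBasis e n) = if m = n then (1 : ℂ) else 0 := by
  rw [Submodule.coe_inner, coe_modeBasis, coe_modeBasis]
  exact orthonormal_iff_ite.1 e.orthonormal m n

lemma inner_annihilation (x y : modeDomain e) :
    inner ℂ (annihilation e x) y = inner ℂ x (creation e y) := by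
  refine inner_mode_ext e (fun m n => ?_) x y
  rw [annihilation_basis, creation_basis, inner_smul_left, inner_smul_right, inner_modeBasis,
    inner_modeBasis, Complex.conj_ofReal]
  cases m with
  | zero => simp
  | succ m =>
    rw [Nat.add_sub_cancel]
    by_cases h : m = n
    · subst h; simp
    · rw [if_neg h, if_neg (by omega), mul_zero, mul_zero]

lemma inner_creation (x y : modeDomain e) :
    inner ℂ (creation e x) y = inner ℂ x (annihilation e y) := by
  rw [← inner_conj_symm, ← inner_annihilation, inner_conj_symm]

lemma inner_number (x y : modeDomain e) : inner ℂ (number e x) y = inner ℂ x (number e y) := by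
  rw [number, Module.End.mul_apply, Module.End.mul_apply, inner_creation, inner_annihilation]

end ModeOperators

/-! ### Symmetry of the Hamiltonians and of the charge. -/

section Symmetry

variable {F : Type*} [NormedAddCommGroup F] [InnerProductSpace ℂ F] {e : HilbertBasis ℕ ℂ F}
  {M : ℕ}

lemma inner_tensorOp {B B' : Matrix (Config M) (Config M) ℂ} (hB : B.conjTranspose = B')
    {S T : Module.End ℂ (modeDomain e)} (hST : ∀ x y, inner ℂ (S x) y = inner ℂ x (T y))
    (φ ψ : fullDomain e M) :
    inner ℂ (tensorOp e B S φ) ψ = inner ℂ φ (tensorOp e B' T ψ) := by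
  subst hB
  rw [Submodule.coe_inner, Submodule.coe_inner, PiLp.inner_apply, PiLp.inner_apply]
  have h : ∀ b c, inner ℂ (S ⟨φ.1 c, φ.2 c⟩ : F) (ψ.1 b) =
      inner ℂ (φ.1 c) (T ⟨ψ.1 b, ψ.2 b⟩ : F) := fun b c => hST ⟨φ.1 c, φ.2 c⟩ ⟨ψ.1 b, ψ.2 b⟩
  change ∑ b, inner ℂ (∑ c, B b c • (S ⟨φ.1 c, φ.2 c⟩ : F)) (ψ.1 b) =
    ∑ c, inner ℂ (φ.1 c) (∑ b, B.conjTranspose c b • (T ⟨ψ.1 b, ψ.2 b⟩ : F))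
  simp only [sum_inner, inner_sum, inner_smul_left, inner_smul_right, h,
    Matrix.conjTranspose_apply]
  exact Finset.sum_comm

lemma isSymmetric_restrictBose {A : Module.End ℂ (fullDomain e M)} (hA : LeavesBoseInvariant e A)
    (h : ∀ φ ψ, inner ℂ (A φ) ψ = inner ℂ φ (A ψ)) :
    LinearMap.IsSymmetric (𝕜 := ℂ) (E := symDomain e M) (restrictBose A hA) :=
  fun φ ψ => h ⟨φ.1.1, φ.2⟩ ⟨ψ.1.1, ψ.2⟩

variable (e M)

lemma isSymmetric_tc1 : LinearMap.IsSymmetric (𝕜 := ℂ) (E := symDomain e M) (tc1 e M) :=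
  isSymmetric_restrictBose _ (inner_tensorOp
    (by rw [collective_conjTranspose, pauli3_conjTranspose]) fun _ _ => rfl)

lemma isSymmetric_tc2 : LinearMap.IsSymmetric (𝕜 := ℂ) (E := symDomain e M) (tc2 e M) :=
  isSymmetric_restrictBose _ fun φ ψ => by
    rw [LinearMap.add_apply, LinearMap.add_apply, inner_add_left, inner_add_right, add_comm,
      inner_tensorOp (B' := collective M pauliPlus) _ (inner_creation e),
      inner_tensorOp (B' := collective M pauliMinus) _ (inner_annihilation e)]
    · rw [collective_conjTranspose, pauliPlus_conjTranspose]
    · rw [collective_conjTranspose, ← pauliPlus_conjTranspose, Matrix.conjTranspose_conjTranspose]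

lemma isSymmetric_tc3 : LinearMap.IsSymmetric (𝕜 := ℂ) (E := symDomain e M) (tc3 e M) :=
  isSymmetric_restrictBose _ (inner_tensorOp (by simp) (inner_number e))

lemma isSymmetric_tcHam (k : Fin 3) :
    LinearMap.IsSymmetric (𝕜 := ℂ) (E := symDomain e M) (tcHam e M k) := by
  fin_cases k
  · exact isSymmetric_tc1 e M
  · exact isSymmetric_tc2 e M
  · exact isSymmetric_tc3 e M

lemma isSymmetric_charge : LinearMap.IsSymmetric (𝕜 := ℂ) (E := symDomain e M) (charge e M) :=
  isSymmetric_restrictBose _ fun φ ψ => by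
    rw [LinearMap.add_apply, LinearMap.add_apply, inner_add_left, inner_add_right,
      inner_tensorOp (B' := 1) _ (inner_number e), inner_tensorOp (T := 1) _ fun _ _ => rfl]
    · simp [Matrix.conjTranspose_smul, collective_conjTranspose, pauli3_conjTranspose]
    · simp

end Symmetry

/-! ### Symmetric vectors, the Dicke basis and the charge spaces. -/

section SymmetricVectors

variable {F : Type*} [NormedAddCommGroup F] [InnerProductSpace ℂ F] (e : HilbertBasis ℕ ℂ F)
  (M : ℕ)

/-- The symmetric vector with component `f (weight b)` at `b`. -/
def symVec : (ℕ → modeDomain e) →ₗ[ℂ] symDomain e M where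
  toFun f := ⟨⟨WithLp.toLp 2 fun b => (f (weight b) : F), fun σ b => by
    change (f (weight (b ∘ σ)) : F) = f (weight b)
    rw [weight_comp]⟩, fun b => (f (weight b)).2⟩
  map_add' _ _ := rfl
  map_smul' _ _ := rfl

variable {M}

lemma symVec_apply (f : ℕ → modeDomain e) (b : Config M) :
    (symVec e M f).1.1 b = (f (weight b) : F) := rfl

variable {e}

lemma symDomain_ext {φ ψ : symDomain e M} (h : ∀ b, φ.1.1 b = ψ.1.1 b) : φ = ψ :=
  Subtype.ext (Subtype.ext (PiLp.ext h))

lemma bose_apply_eq {ψ : FullSpace M F} (hψ : ψ ∈ bose M F) {b c : Config M}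
    (h : weight b = weight c) : ψ b = ψ c := by
  obtain ⟨σ, rfl⟩ := exists_perm_of_weight_eq h
  exact hψ σ c

lemma exists_symVec_eq (ψ : symDomain e M) : ∃ f, symVec e M f = ψ := by
  choose b hb using fun k (hk : k ≤ M) => exists_weight_eq hk
  refine ⟨fun k => if hk : k ≤ M then ⟨ψ.1.1 (b k hk), ψ.2 _⟩ else 0, symDomain_ext fun c => ?_⟩
  rw [symVec_apply, dif_pos (weight_le c)]
  exact bose_apply_eq ψ.1.2 (hb _ _)

/-- Exactly the numbers up to M occur as weights; the values of f beyond M are irrelevant. -/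
lemma symVec_eq_iff {f g : ℕ → modeDomain e} :
    symVec e M f = symVec e M g ↔ ∀ k ≤ M, f k = g k := by
  constructor
  · intro h k hk
    obtain ⟨b, rfl⟩ := exists_weight_eq hk
    have := congrArg (fun ψ : symDomain e M => ψ.1.1 b) h
    exact Subtype.ext this
  · intro h
    refine symDomain_ext fun b => ?_
    rw [symVec_apply, symVec_apply, h _ (weight_le b)]

variable (e M)

lemma tensorOp_symVec (B : Matrix (Config M) (Config M) ℂ) (T : Module.End ℂ (modeDomain e))
    (f : ℕ → modeDomain e) (b : Config M) :
    (tensorOp e B T ⟨(symVec e M f).1.1, (symVec e M f).2⟩).1 b =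
      ((∑ c, B b c • T (f (weight c)) : modeDomain e) : F) := by
  rw [Submodule.coe_sum]
  rfl

lemma tensorOp_collective_symVec (A : Matrix (Fin 2) (Fin 2) ℂ) (T : Module.End ℂ (modeDomain e))
    (f : ℕ → modeDomain e) (b : Config M) :
    (tensorOp e (collective M A) T ⟨(symVec e M f).1.1, (symVec e M f).2⟩).1 b =
      (((weight b : ℂ) • (A 1 0 • T (f (weight b - 1)) + A 1 1 • T (f (weight b))) +
      ((M : ℂ) - weight b) • (A 0 0 • T (f (weight b)) + A 0 1 • T (f (weight b + 1))) :
        modeDomain e) : F) := by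
  rw [tensorOp_symVec, sum_collective A b fun k => T (f k)]

lemma tensorOp_one_symVec (T : Module.End ℂ (modeDomain e))
    (f : ℕ → modeDomain e) (b : Config M) :
    (tensorOp e 1 T ⟨(symVec e M f).1.1, (symVec e M f).2⟩).1 b = (T (f (weight b)) : F) := by
  rw [tensorOp_symVec]
  simp only [Matrix.one_apply, ite_smul, one_smul, zero_smul, Finset.sum_ite_eq, Finset.mem_univ,
    if_true]

lemma tc1_symVec (f : ℕ → modeDomain e) :
    tc1 e M (symVec e M f) = symVec e M fun k => (2 * (k : ℂ) - M) • f k := by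
  refine symDomain_ext fun b => ?_
  rw [symVec_apply]
  refine (tensorOp_collective_symVec e M pauli3 1 f b).trans (congrArg Subtype.val ?_)
  simp only [pauli3, Matrix.of_apply, Matrix.cons_val', Matrix.cons_val_zero, Matrix.cons_val_one,
    Matrix.cons_val_fin_one, Module.End.one_apply]
  module

lemma tc3_symVec (f : ℕ → modeDomain e) :
    tc3 e M (symVec e M f) = symVec e M fun k => number e (f k) :=
  symDomain_ext fun b => tensorOp_one_symVec e M (number e) f b

lemma tc2_symVec (f : ℕ → modeDomain e) :
    tc2 e M (symVec e M f) = symVec e M fun k => (2 * (k : ℂ)) • annihilation e (f (k - 1)) +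
      (2 * ((M : ℂ) - k)) • creation e (f (k + 1)) := by
  refine symDomain_ext fun b => ?_
  rw [symVec_apply]
  refine (congrArg₂ (· + ·) (tensorOp_collective_symVec e M pauliPlus (annihilation e) f b)
    (tensorOp_collective_symVec e M pauliMinus (creation e) f b)).trans ?_
  dsimp only
  rw [← Submodule.coe_add]
  refine congrArg Subtype.val ?_
  rw [pauliPlus_eq, pauliMinus_eq]
  simp only [Matrix.of_apply, Matrix.cons_val', Matrix.cons_val_zero, Matrix.cons_val_one,
    Matrix.cons_val_fin_one]
  module

lemma charge_symVec (f : ℕ → modeDomain e) :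
    charge e M (symVec e M f) = symVec e M fun k => (k : ℂ) • f k + number e (f k) := by
  have h : charge e M (symVec e M f) = (1 / 2 : ℂ) • (tc1 e M (symVec e M f) +
      (M : ℂ) • symVec e M f) + tc3 e M (symVec e M f) := by
    refine symDomain_ext fun b => ?_
    refine congrArg₂ (fun x y : F => x + y) ?_ rfl
    have h1 := tensorOp_symVec e M ((1 / 2 : ℂ) • (collective M pauli3 + (M : ℂ) • 1)) 1 f b
    have h2 := tensorOp_symVec e M (collective M pauli3) 1 f b
    refine h1.trans ?_
    have h3 : (∑ c, ((1 / 2 : ℂ) • (collective M pauli3 + (M : ℂ) • 1)) b c •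
        (1 : Module.End ℂ (modeDomain e)) (f (weight c))) = (1 / 2 : ℂ) •
        ((∑ c, collective M pauli3 b c • (1 : Module.End ℂ (modeDomain e)) (f (weight c))) +
          (M : ℂ) • f (weight b)) := by
      simp only [Matrix.smul_apply, Matrix.add_apply, smul_eq_mul, mul_smul, add_smul,
        Finset.sum_add_distrib, ← Finset.smul_sum, Matrix.one_apply, ite_smul, one_smul,
        zero_smul, Finset.sum_ite_eq, Finset.mem_univ, if_true, Module.End.one_apply]
    rw [h3]
    exact congrArg (fun y => (1 / 2 : ℂ) • (y + (M : ℂ) • (f (weight b) : F))) h2.symm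
  rw [h, tc1_symVec, tc3_symVec, ← map_smul, ← map_add, ← map_smul, ← map_add]
  congr 1
  funext k
  simp only [Pi.add_apply, Pi.smul_apply]
  module

/-- The vector `∑ |b⟩ ⊗ |n⟩`, with the sum over the `b` with `k` excited atoms. -/
def dicke (k n : ℕ) : symDomain e M := symVec e M (Pi.single k (modeBasis e n))

lemma dicke_of_lt {k : ℕ} (hk : M < k) (n : ℕ) : dicke e M k n = 0 := by
  rw [dicke, ← map_zero (symVec e M), symVec_eq_iff]
  intro l hl
  rw [Pi.single_eq_of_ne (by omega)]
  rfl

lemma span_dicke : Submodule.span ℂ (Set.range fun x : ℕ × ℕ => dicke e M x.1 x.2) = ⊤ := by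
  rw [eq_top_iff]
  rintro ψ -
  obtain ⟨f, rfl⟩ := exists_symVec_eq ψ
  have h1 : symVec e M f = ∑ k ∈ Finset.range (M + 1), symVec e M (Pi.single k (f k)) := by
    rw [← map_sum, symVec_eq_iff]
    intro k hk
    rw [Finset.sum_apply, Finset.sum_eq_single k]
    · rw [Pi.single_eq_same]
    · intro l _ hl
      rw [Pi.single_eq_of_ne (Ne.symm hl)]
    · intro h
      exact absurd (Finset.mem_range.2 (by omega)) h
  rw [h1]
  refine Submodule.sum_mem _ fun k _ => ?_
  rw [← (modeBasis e).linearCombination_repr (f k), Finsupp.linearCombination_apply, Finsupp.sum]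
  have h2 : ∀ (s : Finset ℕ) (c : ℕ → ℂ),
      symVec e M (Pi.single k (∑ n ∈ s, c n • modeBasis e n)) = ∑ n ∈ s, c n • dicke e M k n := by
    intro s c
    have := map_sum ((symVec e M) ∘ₗ LinearMap.single ℂ (fun _ => modeDomain e) k)
      (fun n => c n • modeBasis e n) s
    refine this.trans (Finset.sum_congr rfl fun n _ => ?_)
    rw [map_smul]
    rfl
  rw [h2]
  exact Submodule.sum_mem _ fun n _ => Submodule.smul_mem _ _ (Submodule.subset_span ⟨(k, n), rfl⟩)

lemma end_ext_dicke {S T : Module.End ℂ (symDomain e M)}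
    (h : ∀ k n, S (dicke e M k n) = T (dicke e M k n)) : S = T :=
  LinearMap.ext_on_range (span_dicke e M) fun x => h x.1 x.2

lemma tc1_dicke (k n : ℕ) : tc1 e M (dicke e M k n) = (2 * (k : ℂ) - M) • dicke e M k n := by
  rw [dicke, tc1_symVec, ← map_smul]
  congr 1
  funext l
  rcases eq_or_ne l k with rfl | h
  · simp
  · simp [Pi.single_eq_of_ne h]

lemma tc3_dicke (k n : ℕ) : tc3 e M (dicke e M k n) = (n : ℂ) • dicke e M k n := by
  rw [dicke, tc3_symVec, ← map_smul]
  congr 1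
  funext l
  rcases eq_or_ne l k with rfl | h
  · simp [number_basis]
  · simp [Pi.single_eq_of_ne h]

lemma charge_dicke (k n : ℕ) :
    charge e M (dicke e M k n) = ((k + n : ℕ) : ℂ) • dicke e M k n := by
  rw [dicke, charge_symVec, ← map_smul]
  congr 1
  funext l
  rcases eq_or_ne l k with rfl | h
  · simp [number_basis, add_smul]
  · simp [Pi.single_eq_of_ne h]

/-- A configuration of weight k + 1 arises from k + 1 configurations by one excitation, one of
weight k - 1 from M - (k - 1) by one decay. The case k = 0 is set apart because truncated
subtraction would leave a spurious term; for n = 0 the square root vanishes. -/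
lemma tc2_dicke (k n : ℕ) : tc2 e M (dicke e M k n) =
    (2 * ((k : ℂ) + 1) * (Real.sqrt n : ℝ)) • dicke e M (k + 1) (n - 1) +
      if k = 0 then 0 else
        (2 * ((M : ℂ) - (k - 1 : ℕ)) * (Real.sqrt (n + 1) : ℝ)) • dicke e M (k - 1) (n + 1) := by
  have hzero : (0 : symDomain e M) = symVec e M 0 := (map_zero _).symm
  simp only [dicke]
  rw [tc2_symVec, hzero, ← map_smul, ← map_smul, ← apply_ite (symVec e M), ← map_add]
  congr 1
  funext l
  rw [Pi.add_apply, Pi.smul_apply]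
  congr 1
  · rcases Nat.eq_zero_or_pos l with rfl | hl
    · simp
    · obtain ⟨l, rfl⟩ := Nat.exists_eq_succ_of_ne_zero hl.ne'
      rw [Nat.succ_eq_add_one, Nat.add_sub_cancel]
      rcases eq_or_ne l k with rfl | h
      · simp [annihilation_basis, mul_smul]
      · simp [Pi.single_eq_of_ne h, Pi.single_eq_of_ne (show l + 1 ≠ k + 1 by omega)]
  · rcases Nat.eq_zero_or_pos k with rfl | hk
    · simp
    · obtain ⟨k, rfl⟩ := Nat.exists_eq_succ_of_ne_zero hk.ne'
      rw [Nat.succ_eq_add_one, Nat.add_sub_cancel, if_neg (by omega)]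
      rcases eq_or_ne l k with rfl | h
      · simp [creation_basis, mul_smul]
      · simp [Pi.single_eq_of_ne h, Pi.single_eq_of_ne (show l + 1 ≠ k + 1 by omega)]

lemma commute_charge_of_shift {T : Module.End ℂ (symDomain e M)}
    (h : ∀ k n, T (dicke e M k n) ∈ chargeSpace e M (k + n)) :
    Commute (charge e M) T := by
  refine end_ext_dicke e M fun k n => ?_
  rw [Module.End.mul_apply, Module.End.mul_apply, charge_dicke, map_smul]
  exact Module.End.mem_eigenspace_iff.1 (h k n)

lemma dicke_mem (k n : ℕ) : dicke e M k n ∈ chargeSpace e M (k + n) :=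
  Module.End.mem_eigenspace_iff.2 (charge_dicke e M k n)

lemma commute_charge (i : Fin 3) : Commute (charge e M) (tcHam e M i) := by
  refine commute_charge_of_shift e M fun k n => ?_
  fin_cases i
  · change tc1 e M (dicke e M k n) ∈ _
    rw [tc1_dicke]
    exact Submodule.smul_mem _ _ (dicke_mem e M k n)
  · change tc2 e M (dicke e M k n) ∈ _
    rw [tc2_dicke]
    refine Submodule.add_mem _ ?_ ?_
    -- For n = 0 the truncated n - 1 would give the wrong charge, but the coefficient is 0.
    · rcases Nat.eq_zero_or_pos n with rfl | hn
      · simp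
      · refine Submodule.smul_mem _ _ ?_
        have := dicke_mem e M (k + 1) (n - 1)
        rwa [show k + 1 + (n - 1) = k + n by omega] at this
    · split_ifs with hk
      · exact Submodule.zero_mem _
      · refine Submodule.smul_mem _ _ ?_
        have := dicke_mem e M (k - 1) (n + 1)
        rwa [show k - 1 + (n + 1) = k + n by omega] at this
  · change tc3 e M (dicke e M k n) ∈ _
    rw [tc3_dicke]
    exact Submodule.smul_mem _ _ (dicke_mem e M k n)

lemma iSup_chargeSpace : ⨆ μ, chargeSpace e M μ = ⊤ := by
  rw [eq_top_iff, ← span_dicke, Submodule.span_le]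
  rintro _ ⟨x, rfl⟩
  exact Submodule.mem_iSup_of_mem (x.1 + x.2) (dicke_mem e M x.1 x.2)

/-- The vectors `dicke k (μ - k)` span the charge space. -/
lemma chargeSpace_le_span (μ : ℕ) : chargeSpace e M μ ≤
    Submodule.span ℂ (Set.range fun k : Fin (min M μ + 1) => dicke e M k (μ - k)) := by
  intro ψ hψ
  obtain ⟨f, rfl⟩ := exists_symVec_eq ψ
  have h1 := Module.End.mem_eigenspace_iff.1 hψ
  rw [charge_symVec, ← map_smul, symVec_eq_iff] at h1
  -- Comparing coefficients in the eigenvalue equation gives (n + k - μ) times the coefficient equal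
  -- to 0.
  have h2 : ∀ k ≤ M, ∀ n, n + k ≠ μ → (modeBasis e).repr (f k) n = 0 := by
    intro k hk n hn
    have h3 : ∀ x, (modeBasis e).repr (number e x) n = n * (modeBasis e).repr x n := by
      intro x
      have : (modeBasis e).coord n ∘ₗ number e = (n : ℂ) • (modeBasis e).coord n := by
        refine (modeBasis e).ext fun m => ?_
        rw [LinearMap.comp_apply, number_basis, map_smul, LinearMap.smul_apply]
        simp only [Module.Basis.coord_apply, Module.Basis.repr_self, Finsupp.single_apply]
        split_ifs with h
        · rw [h]
        · simp
      exact congrArg (fun g : modeDomain e →ₗ[ℂ] ℂ => g x) this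
    have h4 := congrArg (fun x => (modeBasis e).repr x n) (h1 k hk)
    simp only [map_add, map_smul, Finsupp.add_apply, Finsupp.smul_apply, Pi.smul_apply, h3,
      smul_eq_mul] at h4
    rw [← sub_eq_zero, ← add_mul, ← sub_mul, mul_eq_zero, sub_eq_zero] at h4
    refine h4.resolve_left fun h => hn ?_
    exact_mod_cast (add_comm (n : ℂ) k).trans h
  have h5 : symVec e M f = ∑ k : Fin (min M μ + 1),
      (modeBasis e).repr (f k) (μ - k) • dicke e M k (μ - k) := by
    simp only [dicke, ← map_smul]
    rw [← map_sum, symVec_eq_iff]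
    intro k hk
    rw [Finset.sum_apply]
    apply (modeBasis e).repr.injective
    ext n
    rw [map_sum, Finsupp.finsetSum_apply]
    by_cases hn : n + k = μ
    · rw [Finset.sum_eq_single ⟨k, by omega⟩]
      · simp [show μ - k = n by omega]
      · intro l _ hl
        have : k ≠ l := fun h => hl (Fin.ext h.symm)
        simp [Pi.single_eq_of_ne this]
      · simp
    · rw [h2 k hk n hn, Finset.sum_eq_zero]
      intro l _
      rcases eq_or_ne k l with rfl | h
      · have : μ - (l : ℕ) ≠ n := by omega
        simp [this]
      · simp [Pi.single_eq_of_ne h]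
  rw [h5]
  exact Submodule.sum_mem _ fun k _ => Submodule.smul_mem _ _ (Submodule.subset_span ⟨k, rfl⟩)

lemma dicke_mem_chargeSpace {k μ : ℕ} (h : k ≤ μ) : dicke e M k (μ - k) ∈ chargeSpace e M μ := by
  have := dicke_mem e M k (μ - k)
  rwa [Nat.add_sub_cancel' h] at this

lemma dicke_ne_zero {k : ℕ} (hk : k ≤ M) (n : ℕ) : dicke e M k n ≠ 0 := by
  rw [dicke, ← map_zero (symVec e M), Ne, symVec_eq_iff]
  intro h
  have h1 := h k hk
  rw [Pi.single_eq_same] at h1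
  exact (modeBasis e).ne_zero n h1

/-- The vectors are eigenvectors of H₁ with the distinct eigenvalues 2k - M. -/
lemma linearIndependent_dicke (μ : ℕ) :
    LinearIndependent ℂ fun k : Fin (min M μ + 1) => dicke e M k (μ - k) := by
  refine Module.End.eigenvectors_linearIndependent' (tc1 e M)
    (fun k : Fin (min M μ + 1) => 2 * ((k : ℕ) : ℂ) - M) (fun k l h => ?_) _ fun k => ⟨?_, ?_⟩
  · simpa [Fin.ext_iff] using h
  · exact Module.End.mem_eigenspace_iff.2 (tc1_dicke e M k _)
  · exact dicke_ne_zero e M (by omega) _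

lemma span_dicke_eq_chargeSpace (μ : ℕ) :
    Submodule.span ℂ (Set.range fun k : Fin (min M μ + 1) => dicke e M k (μ - k)) =
      chargeSpace e M μ := by
  refine le_antisymm ?_ (chargeSpace_le_span e M μ)
  rw [Submodule.span_le]
  rintro _ ⟨k, rfl⟩
  exact dicke_mem_chargeSpace e M (by omega)

/-- The basis `dicke k (μ - k)` of the charge space. -/
def chargeBasis (μ : ℕ) : Module.Basis (Fin (min M μ + 1)) ℂ (chargeSpace e M μ) :=
  (Module.Basis.span (linearIndependent_dicke e M μ)).map
    (LinearEquiv.ofEq _ _ (span_dicke_eq_chargeSpace e M μ))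

lemma coe_chargeBasis (μ : ℕ) (k : Fin (min M μ + 1)) :
    (chargeBasis e M μ k : symDomain e M) = dicke e M k (μ - k) := by
  rw [chargeBasis, Module.Basis.map_apply, LinearEquiv.coe_ofEq_apply, Module.Basis.span_apply]

instance finiteDimensional_chargeSpace (μ : ℕ) : FiniteDimensional ℂ (chargeSpace e M μ) :=
  Module.Basis.finiteDimensional_of_finite (chargeBasis e M μ)

end SymmetricVectors

/-! ### The commutator of the ladder matrices. -/

section Ladder

open Matrix

/-- The commutator of a raising and a lowering matrix. -/
lemma commutator_ladder {n : ℕ} {A B : Matrix (Fin (n + 1)) (Fin (n + 1)) ℂ} {α β g : ℕ → ℂ}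
    (hA : ∀ i j : Fin (n + 1), A i j = if (i : ℕ) = j + 1 then α j else 0)
    (hB : ∀ i j : Fin (n + 1), B i j = if (j : ℕ) = i + 1 then β i else 0)
    (h0 : g 0 = -(α 0 * β 0)) (hs : ∀ k < n, g (k + 1) = α k * β k - α (k + 1) * β (k + 1))
    (hn : α n * β n = 0) : A * B - B * A = diagonal fun i : Fin (n + 1) => g i := by
  have hAB : ∀ i k : Fin (n + 1), (A * B) i k =
      if i = k then (if (i : ℕ) = 0 then 0 else α (i - 1) * β (i - 1)) else 0 := by
    intro i k
    rw [mul_apply]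
    by_cases hi : (i : ℕ) = 0
    · rw [if_pos hi, ite_self]
      exact Finset.sum_eq_zero fun j _ => by rw [hA, if_neg (by omega), zero_mul]
    · rw [if_neg hi, Finset.sum_eq_single ⟨i - 1, by omega⟩]
      · rw [hA, hB, if_pos (by simp; omega), mul_ite, mul_zero]
        refine if_congr ?_ rfl rfl
        rw [Fin.ext_iff]
        simp
        omega
      · intro j _ hj
        rw [hA, if_neg, zero_mul]
        intro h
        exact hj (Fin.ext (by simp; omega))
      · simp
  have hBA : ∀ i k : Fin (n + 1), (B * A) i k = if i = k then α i * β i else 0 := by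
    intro i k
    rw [mul_apply]
    by_cases hi : (i : ℕ) = n
    -- The last row of B is zero; `hn` makes the general formula agree with this.
    · rw [Finset.sum_eq_zero fun j _ => by rw [hB, if_neg (by omega), zero_mul], hi, hn, ite_self]
    · rw [Finset.sum_eq_single ⟨i + 1, by omega⟩]
      · rw [hA, hB, if_pos rfl]
        by_cases hik : i = k
        · rw [if_pos hik, if_pos (by simp [hik]), hik, mul_comm]
        · rw [if_neg hik, if_neg, mul_zero]
          intro h
          exact hik (Fin.ext (by simpa using h))
      · intro j _ hj
        rw [hB, if_neg, zero_mul]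
        intro h
        exact hj (Fin.ext (by simpa using h))
      · simp
  ext i k
  rw [Matrix.sub_apply, hAB, hBA, diagonal_apply]
  split_ifs with hik hi
  · rw [hi, h0, zero_sub]
  · obtain ⟨l, hl⟩ := Nat.exists_eq_succ_of_ne_zero hi
    rw [hl, Nat.succ_eq_add_one, hs l (by omega), Nat.add_sub_cancel]
  · rw [sub_zero]

end Ladder

/-! ### The complexified Lie algebra on a charge space. -/

section ChargeSpaces

variable {F : Type*} [NormedAddCommGroup F] [InnerProductSpace ℂ F] (e : HilbertBasis ℕ ℂ F)
  (M : ℕ)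

/-- The matrices, in the basis `dicke k (μ - k)`, of the complex combinations of the elements of
the generated real Lie algebra. -/
def lieMatrices (μ : ℕ) :
    Submodule ℂ (Matrix (Fin (min M μ + 1)) (Fin (min M μ + 1)) ℂ) where
  carrier := {m | ∃ P Q, InTcLie e M P ∧ InTcLie e M Q ∧ ∀ j : Fin (min M μ + 1),
    (P + Complex.I • Q) (dicke e M j (μ - j)) =
      ∑ i : Fin (min M μ + 1), m i j • dicke e M i (μ - i)}
  zero_mem' := ⟨0, 0, .zero, .zero, fun j => by simp⟩
  add_mem' := by
    rintro m m' ⟨P, Q, hP, hQ, h⟩ ⟨P', Q', hP', hQ', h'⟩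
    refine ⟨P + P', Q + Q', .add hP hP', .add hQ hQ', fun j => ?_⟩
    have : P + P' + Complex.I • (Q + Q') = P + Complex.I • Q + (P' + Complex.I • Q') := by module
    rw [this, LinearMap.add_apply, h, h', ← Finset.sum_add_distrib]
    simp_rw [← add_smul]
    rfl
  smul_mem' := by
    rintro z m ⟨P, Q, hP, hQ, h⟩
    refine ⟨(z.re : ℂ) • P + ((-z.im : ℝ) : ℂ) • Q, (z.im : ℂ) • P + (z.re : ℂ) • Q,
      .add (.smul _ hP) (.smul _ hQ), .add (.smul _ hP) (.smul _ hQ), fun j => ?_⟩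
    have : (z.re : ℂ) • P + ((-z.im : ℝ) : ℂ) • Q +
        Complex.I • ((z.im : ℂ) • P + (z.re : ℂ) • Q) = z • (P + Complex.I • Q) := by
      have h1 : (z.re : ℂ) • P + ((-z.im : ℝ) : ℂ) • Q +
        Complex.I • ((z.im : ℂ) • P + (z.re : ℂ) • Q) =
        ((z.re : ℂ) + z.im * Complex.I) • P + (z.re * Complex.I + -z.im) • Q := by
        push_cast; module
      have h2 : (z.re * Complex.I + -z.im : ℂ) = ((z.re : ℂ) + z.im * Complex.I) * Complex.I := by
        linear_combination (-(z.im : ℂ)) * Complex.I_mul_I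
      rw [h1, h2, Complex.re_add_im, mul_smul, ← smul_add]
    rw [this, LinearMap.smul_apply, h, Finset.smul_sum]
    simp_rw [smul_smul]
    rfl

variable {e M}

lemma lieMatrices_mul_apply {μ : ℕ} {R R' : Module.End ℂ (symDomain e M)}
    {m m' : Matrix (Fin (min M μ + 1)) (Fin (min M μ + 1)) ℂ}
    (h : ∀ j : Fin (min M μ + 1), R (dicke e M j (μ - j)) =
      ∑ i : Fin (min M μ + 1), m i j • dicke e M i (μ - i))
    (h' : ∀ j : Fin (min M μ + 1), R' (dicke e M j (μ - j)) =
      ∑ i : Fin (min M μ + 1), m' i j • dicke e M i (μ - i)) (j : Fin (min M μ + 1)) :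
    (R * R') (dicke e M j (μ - j)) =
      ∑ i : Fin (min M μ + 1), (m * m') i j • dicke e M i (μ - i) := by
  rw [Module.End.mul_apply, h', map_sum]
  simp_rw [map_smul, h, Finset.smul_sum, Matrix.mul_apply, Finset.sum_smul]
  rw [Finset.sum_comm]
  refine Finset.sum_congr rfl fun i _ => Finset.sum_congr rfl fun k _ => ?_
  rw [smul_smul, mul_comm]

/-- The complexification of a real Lie algebra is closed under the bracket: the bracket of P + iQ
and P' + iQ' is expanded into its two real components. -/
lemma lieMatrices_bracket {μ : ℕ} :
    ∀ m ∈ lieMatrices e M μ, ∀ m' ∈ lieMatrices e M μ, m * m' - m' * m ∈ lieMatrices e M μ := by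
  rintro m ⟨P, Q, hP, hQ, h⟩ m' ⟨P', Q', hP', hQ', h'⟩
  refine ⟨(P * P' - P' * P) + ((-1 : ℝ) : ℂ) • (Q * Q' - Q' * Q),
    (P * Q' - Q' * P) + (Q * P' - P' * Q), .add (.bracket hP hP') (.smul _ (.bracket hQ hQ')),
    .add (.bracket hP hQ') (.bracket hQ hP'), fun j => ?_⟩
  have : (P * P' - P' * P) + ((-1 : ℝ) : ℂ) • (Q * Q' - Q' * Q) +
      Complex.I • ((P * Q' - Q' * P) + (Q * P' - P' * Q)) =
      (P + Complex.I • Q) * (P' + Complex.I • Q') -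
        (P' + Complex.I • Q') * (P + Complex.I • Q) := by
    simp only [add_mul, mul_add, smul_mul_assoc, mul_smul_comm, smul_add, smul_smul,
      Complex.I_mul_I]
    push_cast
    module
  rw [this, LinearMap.sub_apply, lieMatrices_mul_apply h h', lieMatrices_mul_apply h' h,
    ← Finset.sum_sub_distrib]
  refine Finset.sum_congr rfl fun i _ => ?_
  exact (sub_smul _ _ _).symm

lemma mem_lieMatrices_of_tcHam {μ : ℕ} {m : Matrix (Fin (min M μ + 1)) (Fin (min M μ + 1)) ℂ}
    (k : Fin 3) (h : ∀ j : Fin (min M μ + 1), tcHam e M k (dicke e M j (μ - j)) =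
      ∑ i : Fin (min M μ + 1), m i j • dicke e M i (μ - i)) : m ∈ lieMatrices e M μ := by
  -- The real generators are i H, so H itself is recovered as i · (-(i H)).
  refine ⟨0, ((-1 : ℝ) : ℂ) • Complex.I • tcHam e M k, .zero, .smul _ (.gen k), fun j => ?_⟩
  rw [← h, zero_add, smul_smul, smul_smul]
  push_cast
  rw [mul_neg_one, neg_mul, Complex.I_mul_I, neg_neg, one_smul]

lemma sum_diagonal_smul {n : ℕ} {V : Type*} [AddCommGroup V] [Module ℂ V] (c : Fin n → ℂ)
    (v : Fin n → V) (j : Fin n) : ∑ i, Matrix.diagonal c i j • v i = c j • v j := by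
  simp [Matrix.diagonal_apply]

/-- The hypotheses of `mem_of_ladder` are verified. Without normalisation α and β differ, but only
their product α k β k = 4 (k+1)(M-k)(μ-k) enters the commutator, and it is a polynomial. -/
lemma lieMatrices_eq_top (hM : 1 ≤ M) (μ : ℕ)
    (m : Matrix (Fin (min M μ + 1)) (Fin (min M μ + 1)) ℂ) : m ∈ lieMatrices e M μ := by
  let α : ℕ → ℂ := fun k => 2 * ((k : ℂ) + 1) * (Real.sqrt ((μ - k : ℕ) : ℝ) : ℝ)
  let β : ℕ → ℂ := fun k => 2 * ((M : ℂ) - k) * (Real.sqrt ((μ - k : ℕ) : ℝ) : ℝ)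
  let g : ℕ → ℂ := fun k => 4 * ((k : ℂ) * (M - k + 1) * (μ - k + 1) - (k + 1) * (M - k) * (μ - k))
  let A : Matrix (Fin (min M μ + 1)) (Fin (min M μ + 1)) ℂ :=
    Matrix.of fun i j => if (i : ℕ) = j + 1 then α j else 0
  let B : Matrix (Fin (min M μ + 1)) (Fin (min M μ + 1)) ℂ :=
    Matrix.of fun i j => if (j : ℕ) = i + 1 then β i else 0
  have hαβ : ∀ k ≤ μ, α k * β k = 4 * (((k : ℂ) + 1) * (M - k) * (μ - k)) := by
    intro k hk
    have h1 : ((Real.sqrt ((μ - k : ℕ) : ℝ) : ℝ) : ℂ) * (Real.sqrt ((μ - k : ℕ) : ℝ) : ℝ) =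
        (μ : ℂ) - k := by
      rw [← Complex.ofReal_mul, Real.mul_self_sqrt (by positivity), Nat.cast_sub hk]
      push_cast
      rfl
    simp only [α, β]
    linear_combination 4 * ((k : ℂ) + 1) * (M - k) * h1
  have hsqrt : ∀ k < μ, ((Real.sqrt ((μ - k : ℕ) : ℝ) : ℝ) : ℂ) ≠ 0 := by
    intro k hk
    rw [Complex.ofReal_ne_zero, Real.sqrt_ne_zero', Nat.cast_pos]
    omega
  have hK : (Matrix.diagonal fun i : Fin (min M μ + 1) => 2 * ((i : ℕ) : ℂ) + -M) ∈
      lieMatrices e M μ :=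
    mem_lieMatrices_of_tcHam 0 fun j => by
      rw [sum_diagonal_smul _ fun i : Fin (min M μ + 1) => dicke e M i (μ - i)]
      exact tc1_dicke e M j (μ - j)
  have hN : (Matrix.diagonal fun i : Fin (min M μ + 1) => ((μ - i : ℕ) : ℂ)) ∈
      lieMatrices e M μ :=
    mem_lieMatrices_of_tcHam 2 fun j => by
      rw [sum_diagonal_smul _ fun i : Fin (min M μ + 1) => dicke e M i (μ - i)]
      exact tc3_dicke e M j (μ - j)
  have hABL : A + B ∈ lieMatrices e M μ := by
    refine mem_lieMatrices_of_tcHam 1 fun j => (tc2_dicke e M j (μ - j)).trans ?_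
    simp only [Matrix.add_apply, add_smul, Finset.sum_add_distrib]
    congr 1
    · simp only [A, Matrix.of_apply, ite_smul, zero_smul]
      by_cases hj : (j : ℕ) + 1 < min M μ + 1
      · rw [Finset.sum_eq_single ⟨j + 1, hj⟩]
        · rw [if_pos rfl, Nat.sub_sub]
        · intro i _ hi
          rw [if_neg fun h => hi (Fin.ext h)]
        · simp
      -- At the top of the ladder either all atoms are excited or no photon is left.
      · rw [Finset.sum_eq_zero fun i _ => by rw [if_neg (by omega)]]
        rcases le_total M μ with h | h
        · rw [dicke_of_lt e M (by omega), smul_zero]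
        · rw [show μ - (j : ℕ) = 0 by omega]
          simp
    · simp only [B, Matrix.of_apply, ite_smul, zero_smul]
      by_cases hj : (j : ℕ) = 0
      · rw [if_pos hj, Finset.sum_eq_zero fun i _ => by rw [if_neg (by omega)]]
      · rw [if_neg hj, Finset.sum_eq_single ⟨j - 1, by omega⟩]
        · rw [if_pos (by simp; omega)]
          have h1 : μ - (j : ℕ) + 1 = μ - (j - 1 : ℕ) := by omega
          have h2 : ((μ - (j : ℕ) : ℕ) : ℝ) + 1 = ((μ - (j - 1 : ℕ) : ℕ) : ℝ) := by
            rw [← h1]; push_cast; rfl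
          rw [h2, h1]
        · intro i _ hi
          rw [if_neg fun h => hi (Fin.ext (by simp; omega))]
        · simp
  have hcomm : A * B - B * A = Matrix.diagonal fun i : Fin (min M μ + 1) => g i := by
    refine commutator_ladder (α := α) (β := β) (g := g) (fun _ _ => rfl) (fun _ _ => rfl) ?_
      (fun k hk => ?_) ?_
    · rw [hαβ 0 (Nat.zero_le _)]
      simp only [g]
      push_cast
      ring
    · rw [hαβ k (by omega), hαβ (k + 1) (by omega)]
      simp only [g]
      push_cast
      ring
    · rw [hαβ _ (min_le_right _ _)]
      rcases le_total M μ with h | h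
      · rw [min_eq_left h]; ring
      · rw [min_eq_right h]; ring
  -- For μ > 0 the number operator has positive trace. For μ = 0 it vanishes on the one-dimensional
  -- sector, and H₁, with trace -M, takes its place; here M ≥ 1 enters.
  obtain ⟨T, hT, htr⟩ : ∃ T ∈ lieMatrices e M μ, T.trace ≠ 0 := by
    rcases Nat.eq_zero_or_pos μ with rfl | hμ
    · refine ⟨_, hK, ?_⟩
      rw [Matrix.trace_diagonal, Finset.sum_eq_single 0]
      · simp; omega
      · intro i _ hi
        exact absurd (Fin.ext (by have := i.2; simp; omega)) hi
      · simp
    · refine ⟨_, hN, ?_⟩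
      rw [Matrix.trace_diagonal, ← Nat.cast_sum, Nat.cast_ne_zero]
      refine ne_of_gt (lt_of_lt_of_le hμ ?_)
      exact Finset.single_le_sum (f := fun i : Fin (min M μ + 1) => μ - (i : ℕ))
        (fun _ _ => Nat.zero_le _) (Finset.mem_univ 0)
  refine mem_of_ladder (A := A) (B := B) (α := α) (β := β) (g := g) lieMatrices_bracket two_ne_zero
    (fun _ _ => rfl) (fun _ _ => rfl) hcomm (fun k hk => ?_) (fun k hk => ?_) (fun k l h => ?_) hK
    hABL hT htr m
  · exact mul_ne_zero (mul_ne_zero two_ne_zero (Nat.cast_add_one_ne_zero k)) (hsqrt k (by omega))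
  · refine mul_ne_zero (mul_ne_zero two_ne_zero ?_) (hsqrt k (by omega))
    rw [sub_ne_zero, Ne, Nat.cast_inj]
    omega
  · simp only [g] at h
    push_cast at h
    -- The constant is the inverse of the slope -24 of the differences of g.
    have : (k : ℂ) = l := by linear_combination (-1 / 24 : ℂ) * h
    exact_mod_cast this

/-- Every operator on a charge space is a complex combination of restrictions of elements of the
generated real Lie algebra. -/
lemma exists_lie_eq (hM : 1 ≤ M) (μ : ℕ) (T : Module.End ℂ (chargeSpace e M μ)) :
    ∃ P Q, InTcLie e M P ∧ InTcLie e M Q ∧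
      ∀ x : chargeSpace e M μ, (T x : symDomain e M) = P x + Complex.I • Q x := by
  obtain ⟨P, Q, hP, hQ, h⟩ := lieMatrices_eq_top (e := e) hM μ
    (LinearMap.toMatrix (chargeBasis e M μ) (chargeBasis e M μ) T)
  refine ⟨P, Q, hP, hQ, fun x => ?_⟩
  have : (chargeSpace e M μ).subtype ∘ₗ T = (P + Complex.I • Q) ∘ₗ (chargeSpace e M μ).subtype := by
    refine (chargeBasis e M μ).ext fun j => ?_
    rw [LinearMap.comp_apply, LinearMap.comp_apply, Submodule.subtype_apply,
      Submodule.subtype_apply, coe_chargeBasis, h]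
    conv_lhs => rw [← (chargeBasis e M μ).sum_repr (T (chargeBasis e M μ j))]
    rw [Submodule.coe_sum]
    refine Finset.sum_congr rfl fun i _ => ?_
    rw [Submodule.coe_smul, coe_chargeBasis, LinearMap.toMatrix_apply]
  exact congrArg (fun f : chargeSpace e M μ →ₗ[ℂ] symDomain e M => f x) this

end ChargeSpaces

/-! ### The Hilbert sum of the sectors and the restriction of the Lie algebra. -/

section Final

variable {F : Type*} [NormedAddCommGroup F] [InnerProductSpace ℂ F] (e : HilbertBasis ℕ ℂ F)
  (M : ℕ)

instance completeSpace_bose [CompleteSpace F] : CompleteSpace (bose M F) := by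
  have : IsClosed (bose M F : Set (FullSpace M F)) := by
    have h : (bose M F : Set (FullSpace M F)) =
        ⋂ (σ : Equiv.Perm (Fin M)) (b : Config M), {ψ | ψ (b ∘ σ) = ψ b} := by
      ext ψ
      simp only [Set.mem_iInter]
      rfl
    rw [h]
    exact isClosed_iInter fun σ => isClosed_iInter fun b => isClosed_eq
      (PiLp.continuous_apply 2 _ _) (PiLp.continuous_apply 2 _ _)
  exact this.completeSpace_coe

/-- The charge space as a subspace of the symmetric subspace. -/
def sector (μ : ℕ) : Submodule ℂ (bose M F) := (chargeSpace e M μ).map (symDomain e M).subtype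

/-- The charge space as a Hilbert space. -/
def Sector (μ : ℕ) : Type _ := sector e M μ

instance (μ : ℕ) : NormedAddCommGroup (Sector e M μ) :=
  inferInstanceAs (NormedAddCommGroup (sector e M μ))

instance (μ : ℕ) : InnerProductSpace ℂ (Sector e M μ) :=
  inferInstanceAs (InnerProductSpace ℂ (sector e M μ))

/-- The isometric inclusion of a charge space. -/
def sectorIsometry (μ : ℕ) : Sector e M μ →ₗᵢ[ℂ] bose M F := (sector e M μ).subtypeₗᵢ

/-- The identification of the charge space with its image. -/
def toSector (μ : ℕ) : chargeSpace e M μ ≃ₗ[ℂ] Sector e M μ :=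
  Submodule.equivMapOfInjective (symDomain e M).subtype (Submodule.injective_subtype _) _

lemma sectorIsometry_toSector (μ : ℕ) (x : chargeSpace e M μ) :
    sectorIsometry e M μ (toSector e M μ x) = (x : symDomain e M) := rfl

instance finiteDimensional_sector (μ : ℕ) : FiniteDimensional ℂ (Sector e M μ) :=
  Module.Finite.equiv (toSector e M μ)

instance completeSpace_sector (μ : ℕ) : CompleteSpace (Sector e M μ) :=
  FiniteDimensional.complete ℂ _

/-- The common domain is exactly the algebraic sum of the sectors, as `IsBlockOp` demands. -/
lemma iSup_range_sectorIsometry :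
    ⨆ μ, LinearMap.range (sectorIsometry e M μ).toLinearMap = symDomain e M := by
  have h : ∀ μ, LinearMap.range (sectorIsometry e M μ).toLinearMap =
      (chargeSpace e M μ).map (symDomain e M).subtype := fun μ => Submodule.range_subtype _
  simp_rw [h]
  rw [← Submodule.map_iSup, iSup_chargeSpace, Submodule.map_top, Submodule.range_subtype]

/-- All components of ψ of weight k coincide; c counts the configurations of that weight. -/
lemma inner_dicke (k n : ℕ) (ψ : bose M F) {b : Config M} (hb : weight b = k) :
    ∃ c : ℂ, c ≠ 0 ∧ inner ℂ ((dicke e M k n : symDomain e M) : bose M F) ψ =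
      c * inner ℂ (e n) (ψ.1 b) := by
  classical
  refine ⟨((Finset.univ.filter fun c : Config M => weight c = k).card : ℂ), ?_, ?_⟩
  · rw [Nat.cast_ne_zero, ← Nat.pos_iff_ne_zero, Finset.card_pos]
    exact ⟨b, by simpa using hb⟩
  · rw [Submodule.coe_inner, PiLp.inner_apply]
    have h : ∀ c, inner ℂ (((dicke e M k n : symDomain e M) : bose M F).1 c) (ψ.1 c) =
        if weight c = k then inner ℂ (e n) (ψ.1 b) else 0 := by
      intro c
      rw [dicke, symVec_apply]
      split_ifs with hc
      · rw [hc, Pi.single_eq_same, coe_modeBasis, bose_apply_eq ψ.2 (hc.trans hb.symm)]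
      · rw [Pi.single_eq_of_ne hc, ZeroMemClass.coe_zero, inner_zero_left]
    simp_rw [h]
    rw [← Finset.sum_filter, Finset.sum_const, nsmul_eq_mul]

variable [CompleteSpace F]

lemma symDomain_dense : (symDomain e M).topologicalClosure = ⊤ := by
  rw [Submodule.topologicalClosure_eq_top_iff, Submodule.eq_bot_iff]
  intro ψ hψ
  refine Subtype.ext (PiLp.ext fun b => ?_)
  have h : ∀ n, inner ℂ (e n) (ψ.1 b) = 0 := by
    intro n
    obtain ⟨c, hc, h⟩ := inner_dicke e M (weight b) n ψ rfl
    rw [(Submodule.mem_orthogonal _ _).1 hψ _ (dicke e M (weight b) n).2] at h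
    exact (mul_eq_zero.1 h.symm).resolve_left hc
  have h1 : e.repr (ψ.1 b) = 0 := by
    ext n
    rw [e.repr_apply_apply, h]
    rfl
  simpa using h1

/-- Eigenspaces of the symmetric charge are orthogonal, and together they span the dense domain. -/
lemma isHilbertSum_sector :
    IsHilbertSum ℂ (Sector e M) (sectorIsometry e M) := by
  refine IsHilbertSum.mk ?_ ?_
  · intro μ ν hμν x y
    obtain ⟨x, rfl⟩ := (toSector e M μ).surjective x
    obtain ⟨y, rfl⟩ := (toSector e M ν).surjective y
    have hx := Module.End.mem_eigenspace_iff.1 x.2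
    have hy := Module.End.mem_eigenspace_iff.1 y.2
    have h : inner ℂ ((charge e M x : symDomain e M) : bose M F) ((y : symDomain e M) : bose M F) =
        inner ℂ ((x : symDomain e M) : bose M F) ((charge e M y : symDomain e M) : bose M F) :=
      isSymmetric_charge e M x y
    rw [hx, hy, Submodule.coe_smul (p := symDomain e M), Submodule.coe_smul (p := symDomain e M),
      inner_smul_left, inner_smul_right, ← sub_eq_zero, ← sub_mul, mul_eq_zero,
      Complex.conj_natCast, sub_eq_zero, Nat.cast_inj] at h
    exact h.resolve_left hμν
  · rw [iSup_range_sectorIsometry, symDomain_dense]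

variable {e M}

/-- `a` is the family of the blocks of the operator `A`. -/
def IsBlocks (A : Module.End ℂ (symDomain e M)) (a : ∀ μ, Sector e M μ →L[ℂ] Sector e M μ) :
    Prop :=
  ∀ μ (x : chargeSpace e M μ), sectorIsometry e M μ (a μ (toSector e M μ x)) = A x

lemma IsBlocks.isBlockOp {A : Module.End ℂ (symDomain e M)}
    (hA : LinearMap.IsSymmetric (𝕜 := ℂ) (E := symDomain e M) A)
    {a : ∀ μ, Sector e M μ →L[ℂ] Sector e M μ} (ha : IsBlocks A a) :
    IsBlockOp (sectorIsometry e M) (toPMap A) a where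
  skew μ x y := by
    have h : inner ℂ (a μ x) y = inner ℂ x (a μ y) := by
      obtain ⟨x, rfl⟩ := (toSector e M μ).surjective x
      obtain ⟨y, rfl⟩ := (toSector e M μ).surjective y
      rw [← (sectorIsometry e M μ).inner_map_map,
        ← (sectorIsometry e M μ).inner_map_map (toSector e M μ x), ha, ha]
      exact hA x y
    simp only [smul_apply, inner_smul_left, inner_smul_right, h, Complex.conj_I, neg_mul]
  dom := (iSup_range_sectorIsometry e M).symm
  graph μ x := by
    obtain ⟨x, rfl⟩ := (toSector e M μ).surjective x
    exact (LinearPMap.mem_graph_iff _).2 ⟨x.1, rfl, (ha μ x).symm⟩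

/-- Commuting with the charge preserves its eigenspaces, and on these, being finite-dimensional,
every operator is bounded. -/
lemma exists_isBlocks_of_commute {A : Module.End ℂ (symDomain e M)}
    (hA : Commute (charge e M) A) : ∃ a, IsBlocks A a := by
  have h : ∀ μ, ∀ x ∈ chargeSpace e M μ, A x ∈ chargeSpace e M μ := by
    intro μ x hx
    rw [chargeSpace, Module.End.mem_eigenspace_iff] at hx ⊢
    rw [← Module.End.mul_apply, hA.eq, Module.End.mul_apply, hx, map_smul]
  refine ⟨fun μ => LinearMap.toContinuousLinearMap ((toSector e M μ).conj (A.restrict (h μ))),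
    fun μ x => ?_⟩
  rw [LinearMap.coe_toContinuousLinearMap', LinearEquiv.conj_apply_apply,
    LinearEquiv.symm_apply_apply]
  rfl

variable (e M)

lemma exists_isBlocks_tcHam : ∃ a : Fin 3 → ∀ μ, Sector e M μ →L[ℂ] Sector e M μ,
    (∀ k, IsBlocks (tcHam e M k) (a k)) ∧
    ∀ k, IsBlockOp (sectorIsometry e M) (toPMap (tcHam e M k)) (a k) := by
  choose a ha using fun k => exists_isBlocks_of_commute (commute_charge e M k)
  exact ⟨a, ha, fun k => (ha k).isBlockOp (isSymmetric_tcHam e M k)⟩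

lemma isBlockOp_charge : IsBlockOp (sectorIsometry e M) (toPMap (charge e M))
    fun μ : ℕ => ((μ : ℝ) : ℂ) • 1 := by
  refine IsBlocks.isBlockOp (isSymmetric_charge e M) fun μ x => ?_
  rw [Module.End.mem_eigenspace_iff.1 x.2, Complex.ofReal_natCast]
  rfl

variable {e M}

/-- The elements of the generated Lie algebra are block diagonal, and their exponentials belong
to the dynamical group. -/
lemma exists_blockLie_of_inTcLie {Q : Module.End ℂ (symDomain e M)} (hQ : InTcLie e M Q) :
    ∃ T ∈ blockLie (isHilbertSum_sector e M) (tcGroup e M), IsBlocks Q T := by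
  have hG : IsClosed[strongTopology (bose M F)] (tcGroup e M : Set (bose M F ≃ₗᵢ[ℂ] bose M F)) :=
    isClosed_dynamicalGroup _
  induction hQ with
  | zero => exact ⟨0, zero_mem_blockLie, fun μ x => rfl⟩
  | gen k =>
    obtain ⟨a, ha, hb⟩ := exists_isBlocks_tcHam e M
    refine ⟨_, mem_blockLie_dynamicalGroup (H := fun k => toPMap (tcHam e M k))
      (isHilbertSum_sector e M) (hb k), fun μ x => ?_⟩
    rw [smul_apply, map_smul, ha k μ x]
    rfl
  | add _ _ h1 h2 =>
    obtain ⟨S, hS, hS'⟩ := h1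
    obtain ⟨T, hT, hT'⟩ := h2
    refine ⟨_, add_mem_blockLie hG hS hT, fun μ x => ?_⟩
    rw [add_apply, map_add, hS' μ x, hT' μ x]
    rfl
  | smul r _ h =>
    obtain ⟨T, hT, hT'⟩ := h
    refine ⟨_, smul_mem_blockLie hT r, fun μ x => ?_⟩
    rw [LinearMap.smul_apply, Submodule.coe_smul, ← hT' μ x, ← map_smul]
    rfl
  | bracket _ _ h1 h2 =>
    obtain ⟨S, hS, hS'⟩ := h1
    obtain ⟨T, hT, hT'⟩ := h2
    refine ⟨_, bracket_mem_blockLie hG hS hT, fun μ x => ?_⟩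
    obtain ⟨y, hy⟩ := (toSector e M μ).surjective (S μ (toSector e M μ x))
    obtain ⟨z, hz⟩ := (toSector e M μ).surjective (T μ (toSector e M μ x))
    have hy' := hS' μ x
    have hz' := hT' μ x
    rw [← hy, sectorIsometry_toSector] at hy'
    rw [← hz, sectorIsometry_toSector] at hz'
    rw [sub_apply, mul_apply_eq_comp, mul_apply_eq_comp, map_sub, ← hy, ← hz, hS' μ z,
      hT' μ y, Subtype.ext hy', Subtype.ext hz']
    rfl

/-- The generated Lie algebra restricts to all skew-adjoint operators on a charge space. -/
lemma exists_inTcLie_of_skew (hM : 1 ≤ M) {μ : ℕ} {T : Module.End ℂ (chargeSpace e M μ)}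
    (hT : ∀ φ ψ, inner ℂ (chargeIncl e M μ (T φ)) (chargeIncl e M μ ψ) =
      -inner ℂ (chargeIncl e M μ φ) (chargeIncl e M μ (T ψ))) :
    ∃ Q, InTcLie e M Q ∧ ∀ x : chargeSpace e M μ, (T x : symDomain e M) = Q x := by
  obtain ⟨P, Q, hP, hQ, h⟩ := exists_lie_eq hM μ T
  obtain ⟨p, hp, hp'⟩ := exists_blockLie_of_inTcLie hP
  obtain ⟨q, hq, hq'⟩ := exists_blockLie_of_inTcLie hQ
  have hTpq : ∀ x, toSector e M μ (T x) =
      p μ (toSector e M μ x) + Complex.I • q μ (toSector e M μ x) := fun x =>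
    (sectorIsometry e M μ).injective (by
      rw [sectorIsometry_toSector, h, map_add, map_smul, hp' μ x, hq' μ x]
      rfl)
  -- P alone restricts to T: as T, P and Q are all skew on the sector, 2i⟨y, Qx⟩ = 0 there.
  refine ⟨P, hP, fun x => ?_⟩
  have hq0 : q μ (toSector e M μ x) = 0 := by
    refine ext_inner_left ℂ fun y => ?_
    obtain ⟨y, rfl⟩ := (toSector e M μ).surjective y
    have h1 : inner ℂ (toSector e M μ (T y)) (toSector e M μ x) =
      -inner ℂ (toSector e M μ y) (toSector e M μ (T x)) := hT y x
    rw [hTpq, hTpq, inner_add_left, inner_add_right, hp.1 μ, inner_smul_left, inner_smul_right,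
      hq.1 μ, Complex.conj_I] at h1
    have h2 : Complex.I * inner ℂ (toSector e M μ y) (q μ (toSector e M μ x)) = 0 := by
      linear_combination h1 / 2
    rw [inner_zero_right]
    exact (mul_eq_zero.1 h2).resolve_left Complex.I_ne_zero
  refine Subtype.ext ?_
  have h3 := congrArg (sectorIsometry e M μ) (hTpq x)
  rwa [hq0, smul_zero, add_zero, hp' μ x] at h3

end Final

end TavisCummings

end

theorem mainTheorem8 {F : Type*} [NormedAddCommGroup F] [InnerProductSpace ℂ F] [CompleteSpace F]
    (e : HilbertBasis ℕ ℂ F) (M : ℕ) (hM : 1 ≤ M) :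
    -- the one-parameter groups of the Hamiltonians and of the charge operator exist
    (∀ k, ∃ W, TavisCummings.IsExp (TavisCummings.toPMap (TavisCummings.tcHam e M k)) W) ∧
    (∃ W, TavisCummings.IsExp (TavisCummings.toPMap (TavisCummings.charge e M)) W) ∧
    -- the dynamical group is a strongly closed subgroup of `𝒰(X_M)`
    IsClosed[TavisCummings.strongTopology (TavisCummings.bose M F)]
      (TavisCummings.tcGroup e M : Set (TavisCummings.bose M F ≃ₗᵢ[ℂ] TavisCummings.bose M F)) ∧
    TavisCummings.tcGroup e M ≤
      TavisCummings.chargeGroup (TavisCummings.toPMap (TavisCummings.charge e M)) ∧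
    -- on each charge space it realizes every element of `𝒰(X_M)`
    (∀ V ∈ TavisCummings.chargeGroup (TavisCummings.toPMap (TavisCummings.charge e M)), ∀ μ : ℕ,
      ∃ U ∈ TavisCummings.tcGroup e M, ∀ ψ ∈ TavisCummings.chargeSpace e M μ,
        U (ψ : TavisCummings.bose M F) = V (ψ : TavisCummings.bose M F)) ∧
    -- the generated Lie algebra restricts to the full Lie algebra of skew-adjoint operators
    ∀ μ : ℕ,
      (∀ Q, TavisCummings.InTcLie e M Q → ∀ ψ ∈ TavisCummings.chargeSpace e M μ,
        Q ψ ∈ TavisCummings.chargeSpace e M μ) ∧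
      ∀ T : Module.End ℂ (TavisCummings.chargeSpace e M μ),
        (∃ Q, TavisCummings.InTcLie e M Q ∧ ∀ ψ : TavisCummings.chargeSpace e M μ,
          (T ψ : TavisCummings.symDomain e M) = Q (ψ : TavisCummings.symDomain e M)) ↔
        ∀ φ ψ, inner ℂ (TavisCummings.chargeIncl e M μ (T φ)) (TavisCummings.chargeIncl e M μ ψ) =
          -inner ℂ (TavisCummings.chargeIncl e M μ φ) (TavisCummings.chargeIncl e M μ (T ψ)) := by
  have hJ := TavisCummings.isHilbertSum_sector e M
  have hX := TavisCummings.isBlockOp_charge e M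
  obtain ⟨a, ha, hb⟩ := TavisCummings.exists_isBlocks_tcHam e M
  have hc : Function.Injective fun μ : ℕ => (μ : ℝ) := Nat.cast_injective
  refine ⟨fun k => ⟨_, (hb k).isExp hJ⟩, ⟨_, hX.isExp hJ⟩,
    TavisCummings.isClosed_dynamicalGroup _,
    TavisCummings.dynamicalGroup_le_chargeGroup hJ hX hb, fun V hV μ => ?_, fun μ => ⟨?_, ?_⟩⟩
  · obtain ⟨v, hv⟩ := TavisCummings.exists_block_of_mem_chargeGroup hJ hX hc hV μ
    -- The logarithm t of the block of V is matched by a Lie algebra element on this sector; on the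
    -- other sectors its exponential is unconstrained.
    obtain ⟨t, ht, rfl⟩ := TavisCummings.exists_expSkew_eq v
    obtain ⟨Q, hQ, hQt⟩ := TavisCummings.exists_inTcLie_of_skew hM
      (T := (TavisCummings.toSector e M μ).symm.conj t.toLinearMap) (fun φ ψ => by
        have h : ∀ x, TavisCummings.chargeIncl e M μ
            ((TavisCummings.toSector e M μ).symm.conj t.toLinearMap x) =
            TavisCummings.sectorIsometry e M μ (t (TavisCummings.toSector e M μ x)) := fun x =>
          congrArg (TavisCummings.sectorIsometry e M μ)
          ((TavisCummings.toSector e M μ).apply_symm_apply (t (TavisCummings.toSector e M μ x)))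
        rw [h, h]
        exact ht (TavisCummings.toSector e M μ φ) (TavisCummings.toSector e M μ ψ))
    obtain ⟨T, hT, hTQ⟩ := TavisCummings.exists_blockLie_of_inTcLie hQ
    have hTt : T μ = t := by
      ext1 x
      obtain ⟨x, rfl⟩ := (TavisCummings.toSector e M μ).surjective x
      refine (TavisCummings.sectorIsometry e M μ).injective ((hTQ μ x).trans ?_)
      rw [← hQt x]
      exact congrArg (TavisCummings.sectorIsometry e M μ)
        ((TavisCummings.toSector e M μ).apply_symm_apply (t (TavisCummings.toSector e M μ x)))
    -- The sought U is the one-parameter group of the family T at time 1.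
    refine ⟨_, hT.2 1, fun ψ hψ => ?_⟩
    refine (TavisCummings.blockU_apply hJ _ μ (TavisCummings.toSector e M μ ⟨ψ, hψ⟩)).trans ?_
    rw [one_smul, hTt]
    exact (hv (TavisCummings.toSector e M μ ⟨ψ, hψ⟩)).symm
  · intro Q hQ ψ hψ
    obtain ⟨T, -, hT⟩ := TavisCummings.exists_blockLie_of_inTcLie hQ
    obtain ⟨y, hy⟩ := (TavisCummings.toSector e M μ).surjective
      (T μ (TavisCummings.toSector e M μ ⟨ψ, hψ⟩))
    have h := hT μ ⟨ψ, hψ⟩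
    rw [← hy, TavisCummings.sectorIsometry_toSector] at h
    rw [← Subtype.ext h]
    exact y.2
  · refine fun T => ⟨?_, fun hT => TavisCummings.exists_inTcLie_of_skew hM hT⟩
    rintro ⟨Q, hQ, hTQ⟩
    obtain ⟨S, hS, hSQ⟩ := TavisCummings.exists_blockLie_of_inTcLie hQ
    have hST : ∀ x, TavisCummings.chargeIncl e M μ (T x) =
        TavisCummings.sectorIsometry e M μ (S μ (TavisCummings.toSector e M μ x)) := fun x =>
      (congrArg Subtype.val (hTQ x)).trans (hSQ μ x).symm
    intro φ ψ
    rw [hST, hST]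
    exact hS.1 μ (TavisCummings.toSector e M μ φ) (TavisCummings.toSector e M μ ψ)
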